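/- **Setting.** Work over the field $\mathbb{Q}(A)$ and put $d=-A^{2}-A^{-2}$. For $m,n\ge 0$ let $TL_{m,n}$ be the $\mathbb{Q}(A)$-vector space whose basis consists of the crossingless connections in a rectangle with $m$ marked points on the top edge and $n$ on the bottom edge; the product is stacking, each closed circle being replaced by $d$; $TL_n(d)=TL_{n,n}$. Let $e_i\in TL_n(d)$ be the standard cup–cap generators and let $f_n\in TL_n(d)$ be the Jones–Wenzl idempotent, $$f_n=\frac{1}{(\{n\}_{A^4})!}\sum_{\pi\in S_n}(A^{3})^{|\pi|}\,b_\pi,$$ where $b_\pi$ is the minimal positive braid inducing $\pi$, $|\pi|$ is its length, $\{k\}_q=1+q+\cdots+q^{k-1}$, $(\{n\}_q)!=\{1\}_q\cdots\{n\}_q$, and each braid generator is evaluated by the Kauffman bracket relation $\sigma_i\mapsto A\,\mathbb 1+A^{-1}e_i$. For $n\ge 1$ let $a_1,\dots,a_{2n-1}$ be natural numbers ($0$ allowed) with $a_1=a_{2n-1}=1$ and $|a_i-a_{i-1}|=1$ for $2\le i\le 2n-1$. The element $D_{a_1,\dots,a_{2n-1}}\in TL_n(d)$ is the following diagram. A trunk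 starts at the rightmost top point with label $a_1=1$. Going down, the remaining $n-1$ top strands are merged into it one by one, from right to left, at triple points, so that the trunk carries the labels $a_1,a_2,\dots,a_n$. Then the trunk is split in the mirror-image way, carrying the labels $a_n,a_{n+1},\dots,a_{2n-1}$, into the bottom strands. A segment of the trunk labelled $a$ stands for $a$ parallel strands with $f_a$ inserted. At a triple point with legs $1$ (left), $a$ (right) and $c=a\pm1$, all strands run through if $c=a+1$; if $c=a-1$, the leg $1$ is joined to the leftmost strand of the leg $a$ and the other $c$ strands run through. For crossingless connections $x,y$ in $TL_n(d)$, let $\bar y$ be the reflection of $y$ about the horizontal axis; glue the bottom edge of $x$ to the top edge of $\bar y$ and connect the top points of $x$ with the bottom points of $\bar y$ in order by parallel arcs around an annulus. If the result has $k$ homotopically trivial and $m$ homotopically non-trivial circles, put $\langle x,y\rangle=d^{k}z^{m}$. The bilinear extension $\langle\ ,\ \rangle:TL_n(d)\times TL_n(d)\to\mathbb{Q}(A)[z]$ is the bilinear form of generalized type $A$. **Theorem.** Let $n\ge1$, and let $(a_1,\dots,a_{2n-1})$ and $(b_1,\dots,b_{2n-1})$ be two different sequences as above. Then $$\langle D_{a_1,\dots,a_{2n-1}},\,D_{b_1,\dots,b_{2n-1}}\rangle=0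 .$$ -/

import Mathlib

noncomputable section

namespace TemperleyLieb

/-- The marked points of a rectangle with `m` points on the top edge and `n` on the bottom edge,
both numbered from left to right: `Sum.inl i` is the `i`-th top point and `Sum.inr j` the `j`-th
bottom point. -/
abbrev Point (m n : ℕ) : Type := Fin m ⊕ Fin n

/-- The position of a marked point when the boundary of the rectangle is traversed clockwise,
starting at the upper left corner. -/
def pos {m n : ℕ} : Point m n → ℕ
  | Sum.inl i => i
  | Sum.inr j => m + n - 1 - j

/-- A crossingless connection between the marked points of the rectangle (up to isotopy):
a perfect matching of the marked points, no two arcs of which interlace on the boundary. -/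
@[ext]
structure Diagram (m n : ℕ) where
  /-- the other endpoint of the arc that starts at a given point -/
  mate : Point m n → Point m n
  mate_mate : ∀ p, mate (mate p) = p
  mate_ne : ∀ p, mate p ≠ p
  noncrossing : ∀ p q, ¬ (pos p < pos q ∧ pos q < pos (mate p) ∧ pos (mate p) < pos (mate q))

instance (m n : ℕ) : Finite (Diagram m n) :=
  Finite.of_injective Diagram.mate fun _ _ h => Diagram.ext h

instance (m n : ℕ) : Fintype (Diagram m n) := Fintype.ofFinite _

theorem pos_swap {m n : ℕ} (p : Point m n) : pos p + pos p.swap + 1 = m + n := by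
  rcases p with i | j
  · have := i.isLt
    simp only [pos, Sum.swap_inl]
    omega
  · have := j.isLt
    simp only [pos, Sum.swap_inr]
    omega

/-- The reflection of a crossingless connection about the horizontal axis. -/
def Diagram.reflect {m n : ℕ} (D : Diagram m n) : Diagram n m where
  mate p := (D.mate p.swap).swap
  mate_mate p := by simp [D.mate_mate]
  mate_ne p h := D.mate_ne p.swap (by
    have := congrArg Sum.swap h
    simpa using this)
  noncrossing p q h := by
    have hp := pos_swap p
    have hq := pos_swap q
    have hp' := pos_swap (D.mate p.swap)
    have hq' := pos_swap (D.mate q.swap)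
    refine D.noncrossing (D.mate q.swap) (D.mate p.swap) ?_
    rw [D.mate_mate, D.mate_mate]
    omega

/-! ### Coefficients -/

/-- The field `ℚ(A)` of rational functions. -/
abbrev K : Type := RatFunc ℚ

/-- The variable `A`. -/
def A : K := RatFunc.X

/-- The value `d = -A⁻² - A²` of a trivial circle. -/
def d : K := -(A⁻¹) ^ 2 - A ^ 2

/-- `TL m n` is the space of formal `ℚ(A)`-linear combinations of crossingless connections
(the morphism space of the Temperley–Lieb category); `TL n n` is the Temperley–Lieb algebra. -/
abbrev TL (m n : ℕ) : Type := Diagram m n → K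

/-! ### Composition: stacking diagrams -/

/-- Points of `D₁` (on top) and `D₂` (below) that are directly joined when `D₂` is stacked below
`D₁`. -/
inductive StackAdj {m n k : ℕ} (D₁ : Diagram m n) (D₂ : Diagram n k) :
    Point m n ⊕ Point n k → Point m n ⊕ Point n k → Prop
  | upper (p : Point m n) : StackAdj D₁ D₂ (Sum.inl p) (Sum.inl (D₁.mate p))
  | lower (p : Point n k) : StackAdj D₁ D₂ (Sum.inr p) (Sum.inr (D₂.mate p))
  | middle (i : Fin n) : StackAdj D₁ D₂ (Sum.inl (Sum.inr i)) (Sum.inr (Sum.inl i))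

/-- The connected curves (arcs and circles) in the stack of `D₁` and `D₂`. -/
abbrev StackCurve {m n k : ℕ} (D₁ : Diagram m n) (D₂ : Diagram n k) : Type :=
  Quot (StackAdj D₁ D₂)

/-- The curve of the stack through a given point of the outer boundary. -/
def outerCurve {m n k : ℕ} (D₁ : Diagram m n) (D₂ : Diagram n k) : Point m k → StackCurve D₁ D₂
  | Sum.inl i => Quot.mk _ (Sum.inl (Sum.inl i))
  | Sum.inr j => Quot.mk _ (Sum.inr (Sum.inr j))

/-- The number of closed circles in the stack of `D₁` and `D₂`. -/
def stackCircles {m n k : ℕ} (D₁ : Diagram m n) (D₂ : Diagram n k) : ℕ :=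
  Nat.card {c : StackCurve D₁ D₂ // ∀ p, c ≠ outerCurve D₁ D₂ p}

/-- `E` is the crossingless connection that is left of the stack of `D₁` and `D₂` after the
closed circles are removed: each arc of `E` joins two points on one curve of the stack. -/
def IsStack {m n k : ℕ} (D₁ : Diagram m n) (D₂ : Diagram n k) (E : Diagram m k) : Prop :=
  ∀ p, outerCurve D₁ D₂ (E.mate p) = outerCurve D₁ D₂ p

open Classical in
/-- The product of the Temperley–Lieb category (`x` above `y`): the bilinear extension of
stacking, where each closed circle is replaced by the factor `d`. -/
def comp {m n k : ℕ} (x : TL m n) (y : TL n k) : TL m k := fun E =>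
  ∑ D₁ : Diagram m n, ∑ D₂ : Diagram n k,
    if IsStack D₁ D₂ E then d ^ stackCircles D₁ D₂ * x D₁ * y D₂ else 0

/-- The linear extension of the reflection about the horizontal axis. -/
def reflect {m n : ℕ} (x : TL m n) : TL n m := fun D => x D.reflect

open Classical in
/-- The linear extension of the operation that adds a vertical strand on the left of a diagram. -/
def addLeft {m n : ℕ} (x : TL m n) : TL (m + 1) (n + 1) := fun E =>
  ∑ D : Diagram m n,
    if E.mate (Sum.inl 0) = Sum.inr 0 ∧
        ∀ p : Point m n, E.mate (Sum.map Fin.succ Fin.succ p) = Sum.map Fin.succ Fin.succ (D.mate p)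
    then x D else 0

open Classical in
/-- For `m = n`, the identity diagram: the `i`-th top point is joined to the `i`-th bottom point.
(The two indices are kept apart only to avoid casts; it is used when they are equal.) -/
def wire (m n : ℕ) : TL m n := fun E =>
  if ∀ (i : Fin m) (j : Fin n), i.val = j.val → E.mate (Sum.inl i) = Sum.inr j then 1 else 0

open Classical in
/-- The generator `e_i` (`i` counted from `0`): a cup and a cap at the positions `i` and `i + 1`,
vertical strands elsewhere. -/
def e {n : ℕ} (i : Fin (n - 1)) : TL n n := fun E =>
  if E.mate (Sum.inl ⟨i, by omega⟩) = Sum.inl ⟨i + 1, by omega⟩ ∧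
      E.mate (Sum.inr ⟨i, by omega⟩) = Sum.inr ⟨i + 1, by omega⟩ ∧
      ∀ j : Fin n, j.val ≠ i.val → j.val ≠ i.val + 1 → E.mate (Sum.inl j) = Sum.inr j
  then 1 else 0

/-! ### Jones–Wenzl idempotents -/

/-- The Artin generator of the braid group, resolved by the Kauffman bracket skein relation. -/
def crossing {n : ℕ} (i : Fin (n - 1)) : TL n n := A • wire n n + A⁻¹ • e i

/-- The image in `TL n n` of a positive braid word. -/
def braidWord {n : ℕ} (w : List (Fin (n - 1))) : TL n n :=
  w.foldr (fun i x => comp (crossing i) x) (wire n n)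

/-- The adjacent transposition of `i` and `i + 1`. -/
def adjSwap {n : ℕ} (i : Fin (n - 1)) : Equiv.Perm (Fin n) :=
  Equiv.swap ⟨i, by omega⟩ ⟨i + 1, by omega⟩

/-- The permutation induced by a positive braid word. -/
def wordPerm {n : ℕ} (w : List (Fin (n - 1))) : Equiv.Perm (Fin n) := (w.map adjSwap).prod

theorem exists_word {n : ℕ} (π : Equiv.Perm (Fin n)) :
    {w : List (Fin (n - 1)) | wordPerm w = π}.Nonempty := by
  cases n with
  | zero => exact ⟨[], Subsingleton.elim _ _⟩
  | succ k =>
    have h : π ∈ Submonoid.closure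
        (Set.range fun i : Fin k => Equiv.swap i.castSucc i.succ) := by
      rw [Equiv.Perm.mclosure_swap_castSucc_succ]
      trivial
    induction h using Submonoid.closure_induction with
    | mem x hx =>
      obtain ⟨i, rfl⟩ := hx
      refine ⟨[i], ?_⟩
      simp only [Set.mem_ofPred_eq, wordPerm, List.map_cons, List.map_nil, List.prod_cons,
        List.prod_nil, mul_one]
      rfl
    | one => exact ⟨[], rfl⟩
    | mul x y _ _ hx hy =>
      obtain ⟨u, rfl⟩ := hx
      obtain ⟨v, rfl⟩ := hy
      exact ⟨u ++ v, by simp [wordPerm]⟩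

/-- A positive braid word of minimal length that induces the permutation `π`. -/
def minWord {n : ℕ} (π : Equiv.Perm (Fin n)) : List (Fin (n - 1)) :=
  Function.argminOn List.length {w | wordPerm w = π} (exists_word π)

/-- The quantum integer `{k}_q = 1 + q + ⋯ + q ^ (k - 1)`. -/
def qInt (q : K) (k : ℕ) : K := ∑ j ∈ Finset.range k, q ^ j

/-- The quantum factorial `{1}_q {2}_q ⋯ {n}_q`. -/
def qFactorial (q : K) (n : ℕ) : K := ∏ k ∈ Finset.Icc 1 n, qInt q k

/-- The Jones–Wenzl idempotent `f_n`: the sum of `A ^ (3 |π|) b_π` over all permutations `π`,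
divided by `{n}_{A ^ 4}!`, where `b_π` is the minimal positive braid that induces `π` and
`|π|` is its length. -/
def jonesWenzl (n : ℕ) : TL n n :=
  (qFactorial (A ^ 4) n)⁻¹ •
    ∑ π : Equiv.Perm (Fin n), (A ^ 3) ^ (minWord π).length • braidWord (minWord π)

/-! ### The elements `D` -/

open Classical in
/-- The wiring inside an admissible triple point with upper left leg `1`, upper right leg `a` and
lower leg `c`, where `c = a + 1` or `a = c + 1`. If `c = a + 1`, all strands run vertically.
If `a = c + 1`, one strand joins the left leg to the leftmost point of the right leg, and the
other `c` strands run from the right leg to the lower leg. -/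
def tripleWiring (a c : ℕ) : TL (a + 1) c := fun E =>
  if (∀ (i : Fin (a + 1)) (j : Fin c), i.val + c = j.val + (a + 1) →
        E.mate (Sum.inl i) = Sum.inr j) ∧
      (a = c + 1 → ∀ i i' : Fin (a + 1), i.val = 0 → i'.val = 1 →
        E.mate (Sum.inl i) = Sum.inl i')
  then 1 else 0

/-- The admissible triple point with legs `1`, `a` and `c`, with a Jones–Wenzl idempotent on each
leg (`f_1` is the identity). -/
def triplePoint (a c : ℕ) : TL (a + 1) c :=
  comp (addLeft (jonesWenzl a)) (comp (tripleWiring a c) (jonesWenzl c))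

/-- The upper half of `D`: a tree with `k` leaves. The trunk starts as the rightmost leaf and
carries the labels `s 1, …, s (k - 1), c`; at each triple point the next leaf on the left is
merged into it. -/
def halfTree (s : ℕ → ℕ) : (k c : ℕ) → TL k c
  | 0, c => wire 0 c
  | 1, c => wire 1 c
  | k + 2, c => comp (addLeft (halfTree s (k + 1) (s (k + 1)))) (triplePoint (s (k + 1)) c)

/-- The element `D_{a_1, …, a_{2n-1}}` of `TL n n`: the leaves on the top edge merge along
`a_1, …, a_n`, and the trunk splits again along `a_n, …, a_{2n-1}` into the leaves on the bottom
edge. Only the values `a 1, …, a (2 * n - 1)` matter. -/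
def D (n : ℕ) (a : ℕ → ℕ) : TL n n :=
  comp (halfTree a n (a n)) (reflect (halfTree (fun i => a (2 * n - i)) n (a n)))

/-- The sequence `a_1, …, a_{2n-1}` satisfies `a_1 = a_{2n-1} = 1` and `|a_i - a_{i-1}| = 1`. -/
structure Admissible (n : ℕ) (a : ℕ → ℕ) : Prop where
  first : a 1 = 1
  last : a (2 * n - 1) = 1
  step : ∀ i, 2 ≤ i → i ≤ 2 * n - 1 → |(a i : ℤ) - (a (i - 1) : ℤ)| = 1

/-! ### The bilinear form of generalized type A -/

/-- Points that are directly joined when `b`, reflected about the horizontal axis, is glued below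
`a`, and the top edge is connected with the bottom edge around the annulus. -/
inductive ClosureAdj {n : ℕ} (a b : Diagram n n) :
    Point n n ⊕ Point n n → Point n n ⊕ Point n n → Prop
  | upper (p : Point n n) : ClosureAdj a b (Sum.inl p) (Sum.inl (a.mate p))
  | lower (p : Point n n) : ClosureAdj a b (Sum.inr p) (Sum.inr (b.reflect.mate p))
  | middle (i : Fin n) : ClosureAdj a b (Sum.inl (Sum.inr i)) (Sum.inr (Sum.inl i))
  | closing (i : Fin n) : ClosureAdj a b (Sum.inl (Sum.inl i)) (Sum.inr (Sum.inr i))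

/-- The circles in the annulus that result from `a` and `b`. -/
abbrev Circle {n : ℕ} (a b : Diagram n n) : Type := Quot (ClosureAdj a b)

/-- The number of closing strands on a circle, that is, the number of its intersections with a
radial segment of the annulus that meets each of the `n` closing strands once and nothing else. -/
def closingStrands {n : ℕ} {a b : Diagram n n} (c : Circle a b) : ℕ :=
  Nat.card {i : Fin n // Quot.mk (ClosureAdj a b) (Sum.inl (Sum.inl i)) = c}

/-- The number of homotopically trivial circles. (A simple closed curve in the annulus winds
`0` or `±1` times around it, so it is trivial iff it meets a radial segment an even number of
times.) -/
def trivialCircles {n : ℕ} (a b : Diagram n n) : ℕ :=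
  Nat.card {c : Circle a b // Even (closingStrands c)}

/-- The number of homotopically non-trivial circles. -/
def essentialCircles {n : ℕ} (a b : Diagram n n) : ℕ :=
  Nat.card {c : Circle a b // Odd (closingStrands c)}

/-- The bilinear form of generalized type A, with values in `ℚ(A)[z]`: the bilinear extension
of `⟨a, b⟩ = d ^ k * z ^ m`, where `k` and `m` are the numbers of homotopically trivial and
non-trivial circles. -/
def form {n : ℕ} (x y : TL n n) : Polynomial K :=
  ∑ a : Diagram n n, ∑ b : Diagram n n,
    Polynomial.C (x a * y b) *
      (Polynomial.C d ^ trivialCircles a b * Polynomial.X ^ essentialCircles a b)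

end TemperleyLieb

end

/-!
The form is a cyclic trace: `⟨x, y⟩` is the annular closure of `x ȳ`, and the closure of `x y` is
that of `y x`. Hence `⟨D_a, D_b⟩` contains the product of the two upper half trees and the product
of the two lower half trees, and the labels differ in at least one of the two halves. Where they
differ at the trunk, the product has the factor `f_p x f_q` with `p ≠ q`; every crossingless
connection between `p` and `q` points has a cup or cap of neighboring points at its larger end,
and this is killed by the Jones–Wenzl idempotent. Otherwise two equal triple points face each other
around the product of the smaller half trees, which vanishes by induction.

The topology is replaced by counting colorings of the marked points that are constant along arcs.
They turn a crossingless connection into a matrix that determines it, and stacking into the matrix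
product, where each circle contributes a factor equal to the number of colors. Associativity and
the relations among the `e_i` are then matrix identities. For the annulus, colors of weight `±1` on
the closing strands separate trivial from essential circles.
-/

noncomputable section

namespace TemperleyLieb

/-! ### Curves of a stack -/

section Involutions

variable {X : Type*} {α β : Equiv.Perm X} {p x : X}

theorem zpow_apply_eq_zpow_apply_iff (φ : Equiv.Perm X) (p : X) (k l : ℤ) :
    (φ ^ k) p = (φ ^ l) p ↔ (Function.minimalPeriod φ p : ℤ) ∣ k - l := by
  have hdvd : (φ ^ (k - l)) p = p ↔ (Function.minimalPeriod φ p : ℤ) ∣ k - l :=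
    MulAction.zpow_smul_eq_iff_minimalPeriod_dvd (a := φ) (b := p)
  rw [← hdvd, sub_eq_neg_add, zpow_add, Equiv.Perm.mul_apply, zpow_neg,
    Equiv.Perm.inv_eq_iff_eq]

theorem apply_mul_zpow_apply_of_fixed (hα : Function.Involutive α) (hβ : Function.Involutive β)
    (hp : β p = p) (k : ℤ) : β (((β * α) ^ k) p) = ((β * α) ^ (-k)) p := by
  have hconj : β * (β * α) * β⁻¹ = (β * α)⁻¹ := by
    ext x
    rw [eq_comm, Equiv.Perm.inv_eq_iff_eq]
    simp [hα _, hβ _]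
  have hp' : β⁻¹ p = p := by rw [Equiv.Perm.inv_eq_iff_eq, hp]
  rw [zpow_neg, ← inv_zpow, ← hconj, conj_zpow, Equiv.Perm.mul_apply, Equiv.Perm.mul_apply, hp']

theorem apply_mul_zpow_apply_of_fixed' (hα : Function.Involutive α) (hβ : Function.Involutive β)
    (hp : β p = p) (k : ℤ) : α (((β * α) ^ k) p) = ((β * α) ^ (-(k + 1))) p := by
  rw [← apply_mul_zpow_apply_of_fixed hα hβ hp, add_comm, zpow_add, zpow_one,
    Equiv.Perm.mul_apply, Equiv.Perm.mul_apply, hβ]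

theorem sameCycle_mul_apply_of_fixed (hα : Function.Involutive α) (hβ : Function.Involutive β)
    (hp : β p = p) (h : (β * α).SameCycle p x) : (β * α).SameCycle p (β x) := by
  obtain ⟨k, rfl⟩ := h
  exact ⟨-k, (apply_mul_zpow_apply_of_fixed hα hβ hp k).symm⟩

theorem sameCycle_mul_apply_of_fixed' (hα : Function.Involutive α) (hβ : Function.Involutive β)
    (hp : β p = p) (h : (β * α).SameCycle p x) : (β * α).SameCycle p (α x) := by
  obtain ⟨k, rfl⟩ := h
  exact ⟨-(k + 1), (apply_mul_zpow_apply_of_fixed' hα hβ hp k).symm⟩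

theorem even_minimalPeriod_mul_of_fixed (hα : Function.Involutive α) (hne : ∀ x, α x ≠ x)
    (hβ : Function.Involutive β) (hp : β p = p) : Even (Function.minimalPeriod (β * α) p) := by
  by_contra hodd
  obtain ⟨j, hj⟩ := Nat.not_even_iff_odd.1 hodd
  apply hne (((β * α) ^ (j : ℤ)) p)
  rw [apply_mul_zpow_apply_of_fixed' hα hβ hp, zpow_apply_eq_zpow_apply_iff, hj]
  exact ⟨-1, by push_cast; ring⟩

/-- The orbit of `p` under the dihedral group generated by `α` and `β` is a path, since the fixed
point `p` of `β` is an end of it. -/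
theorem existsUnique_other_fixedPoint [Finite X] (hα : Function.Involutive α)
    (hne : ∀ x, α x ≠ x) (hβ : Function.Involutive β) (hp : β p = p) :
    ∃! q, q ≠ p ∧ β q = q ∧ (β * α).SameCycle p q := by
  obtain ⟨h, hN⟩ := even_minimalPeriod_mul_of_fixed hα hne hβ hp
  have hpos : 0 < Function.minimalPeriod (β * α) p :=
    Function.minimalPeriod_pos_of_mem_periodicPts
      (Function.Injective.mem_periodicPts (β * α).injective p)
  have eq_iff (k l : ℤ) :
      ((β * α) ^ k) p = ((β * α) ^ l) p ↔ (2 * h : ℤ) ∣ k - l := by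
    rw [zpow_apply_eq_zpow_apply_iff, hN, Nat.cast_add, two_mul]
  have fixed_iff (k : ℤ) : β (((β * α) ^ k) p) = ((β * α) ^ k) p ↔ (h : ℤ) ∣ k := by
    rw [apply_mul_zpow_apply_of_fixed hα hβ hp, eq_iff, show -k - k = 2 * (-k) by ring,
      mul_dvd_mul_iff_left two_ne_zero, dvd_neg]
  have ne_iff (k : ℤ) : ((β * α) ^ k) p ≠ p ↔ ¬ (2 * h : ℤ) ∣ k := by
    simpa using (eq_iff k 0).not
  refine ⟨((β * α) ^ (h : ℤ)) p, ⟨?_, (fixed_iff h).2 dvd_rfl, h, rfl⟩, ?_⟩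
  · rw [ne_iff]
    intro hdvd
    have := Int.le_of_dvd (by omega) hdvd
    omega
  · rintro _ ⟨hk, hfix, k, rfl⟩
    obtain ⟨t, rfl⟩ := (fixed_iff k).1 hfix
    rw [ne_iff] at hk
    rw [eq_iff]
    obtain ⟨r, rfl | rfl⟩ := Int.even_or_odd' t
    · exact absurd ⟨r, by ring⟩ hk
    · exact ⟨r, by ring⟩

end Involutions

variable {m n k l : ℕ}

theorem mates_involutive (P : Diagram m n) (Q : Diagram n k) :
    Function.Involutive (Sum.map P.mate Q.mate) := by
  rintro (x | x)
  · exact congrArg Sum.inl (P.mate_mate x)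
  · exact congrArg Sum.inr (Q.mate_mate x)

theorem mates_ne (P : Diagram m n) (Q : Diagram n k) (x : Point m n ⊕ Point n k) :
    Sum.map P.mate Q.mate x ≠ x := by
  rcases x with x | x
  · exact fun h => P.mate_ne x (Sum.inl_injective h)
  · exact fun h => Q.mate_ne x (Sum.inr_injective h)

/-- The gluing of a stack: it exchanges the two copies of a point of the middle line and fixes the
points of the outer boundary. -/
def glue : Point m n ⊕ Point n k → Point m n ⊕ Point n k
  | Sum.inl (Sum.inl i) => Sum.inl (Sum.inl i)
  | Sum.inl (Sum.inr i) => Sum.inr (Sum.inl i)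
  | Sum.inr (Sum.inl i) => Sum.inl (Sum.inr i)
  | Sum.inr (Sum.inr i) => Sum.inr (Sum.inr i)

theorem glue_involutive : Function.Involutive (glue : Point m n ⊕ Point n k → _) := by
  rintro ((x | x) | (x | x)) <;> rfl

/-- The inclusion of the outer boundary into the points of a stack. -/
def outerPoint : Point m k → Point m n ⊕ Point n k :=
  Sum.map Sum.inl Sum.inr

theorem outerPoint_injective :
    Function.Injective (outerPoint : Point m k → Point m n ⊕ Point n k) :=
  Sum.map_injective.2 ⟨Sum.inl_injective, Sum.inr_injective⟩

theorem glue_eq_self_iff {x : Point m n ⊕ Point n k} : glue x = x ↔ ∃ p, outerPoint p = x := by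
  rcases x with (x | x) | (x | x) <;> simp [glue, outerPoint]

theorem outerCurve_eq (P : Diagram m n) (Q : Diagram n k) (p : Point m k) :
    outerCurve P Q p = Quot.mk _ (outerPoint p) := by
  rcases p with p | p <;> rfl

/-- Runs along one arc of a diagram of the stack and then through the middle line. -/
def stackStep (P : Diagram m n) (Q : Diagram n k) : Equiv.Perm (Point m n ⊕ Point n k) :=
  glue_involutive.toPerm * (mates_involutive P Q).toPerm

theorem curve_stackStep (P : Diagram m n) (Q : Diagram n k) (x : Point m n ⊕ Point n k) :
    Quot.mk (StackAdj P Q) (stackStep P Q x) = Quot.mk _ x := by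
  have curve_glue (y : Point m n ⊕ Point n k) :
      Quot.mk (StackAdj P Q) (glue y) = Quot.mk _ y := by
    rcases y with (i | i) | (i | i)
    · rfl
    · exact (Quot.sound (StackAdj.middle i)).symm
    · exact Quot.sound (StackAdj.middle i)
    · rfl
  refine (curve_glue _).trans ?_
  rcases x with x | x
  · exact (Quot.sound (StackAdj.upper x)).symm
  · exact (Quot.sound (StackAdj.lower x)).symm

theorem outerCurve_eq_iff_sameCycle (P : Diagram m n) (Q : Diagram n k) (p q : Point m k) :
    outerCurve P Q q = outerCurve P Q p ↔
      (stackStep P Q).SameCycle (outerPoint p) (outerPoint q) := by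
  rw [outerCurve_eq, outerCurve_eq]
  constructor
  · intro h
    have hfix : glue (outerPoint p : Point m n ⊕ Point n k) = outerPoint p :=
      glue_eq_self_iff.2 ⟨p, rfl⟩
    have mates_mem {x} (hx : (stackStep P Q).SameCycle (outerPoint p) x) :
        (stackStep P Q).SameCycle (outerPoint p) (Sum.map P.mate Q.mate x) :=
      sameCycle_mul_apply_of_fixed' (mates_involutive P Q) glue_involutive hfix hx
    have glue_mem {x} (hx : (stackStep P Q).SameCycle (outerPoint p) x) :
        (stackStep P Q).SameCycle (outerPoint p) (glue x) :=
      sameCycle_mul_apply_of_fixed (mates_involutive P Q) glue_involutive hfix hx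
    have mem_eq (x y) (hxy : StackAdj P Q x y) :
        (stackStep P Q).SameCycle (outerPoint p) x =
          (stackStep P Q).SameCycle (outerPoint p) y := by
      rw [eq_iff_iff]
      induction hxy with
      | upper x => exact ⟨mates_mem, fun hx => by simpa [P.mate_mate] using mates_mem hx⟩
      | lower x => exact ⟨mates_mem, fun hx => by simpa [Q.mate_mate] using mates_mem hx⟩
      | middle i => exact ⟨glue_mem, glue_mem⟩
    exact (congrArg (Quot.lift _ mem_eq) h).mpr (Equiv.Perm.SameCycle.refl _ _)
  · intro h
    obtain ⟨j, hj⟩ := h.exists_nat_pow_eq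
    rw [← hj]
    clear hj
    induction j with
    | zero => rfl
    | succ j ih => rw [pow_succ', Equiv.Perm.mul_apply, curve_stackStep, ih]

theorem existsUnique_other_end (P : Diagram m n) (Q : Diagram n k) (p : Point m k) :
    ∃! q, q ≠ p ∧ outerCurve P Q q = outerCurve P Q p := by
  obtain ⟨_, ⟨hne, hfix, hcycle⟩, huniq⟩ := existsUnique_other_fixedPoint
    (α := (mates_involutive P Q).toPerm) (mates_involutive P Q) (mates_ne P Q)
    (β := glue_involutive.toPerm) glue_involutive (glue_eq_self_iff.2 ⟨p, rfl⟩)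
  obtain ⟨q, rfl⟩ := glue_eq_self_iff.1 hfix
  refine ⟨q, ⟨fun h => hne (h ▸ rfl), (outerCurve_eq_iff_sameCycle P Q p q).2 hcycle⟩, ?_⟩
  rintro r ⟨hrp, hr⟩
  exact outerPoint_injective (huniq _ ⟨outerPoint_injective.ne hrp, glue_eq_self_iff.2 ⟨r, rfl⟩,
    (outerCurve_eq_iff_sameCycle P Q p r).1 hr⟩)

theorem IsStack.outerCurve_eq_iff {P : Diagram m n} {Q : Diagram n k} {R : Diagram m k}
    (h : IsStack P Q R) {p q : Point m k} :
    outerCurve P Q q = outerCurve P Q p ↔ q = p ∨ q = R.mate p := by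
  constructor
  · intro hpq
    by_cases hne : q = p
    · exact Or.inl hne
    · exact Or.inr ((existsUnique_other_end P Q p).unique ⟨hne, hpq⟩ ⟨R.mate_ne p, h p⟩)
  · rintro (rfl | rfl)
    · rfl
    · exact h p

theorem IsStack.unique {P : Diagram m n} {Q : Diagram n k} {R S : Diagram m k}
    (hR : IsStack P Q R) (hS : IsStack P Q S) : R = S :=
  Diagram.ext (funext fun p =>
    (hS.outerCurve_eq_iff.1 (hR p)).resolve_left (R.mate_ne p))

/-! ### A stack is crossingless -/

theorem pos_injective : Function.Injective (pos : Point m n → ℕ) := by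
  rintro (x | x) (y | y) h <;> simp only [pos] at h
  · exact congrArg Sum.inl (Fin.ext h)
  · omega
  · omega
  · exact congrArg Sum.inr (Fin.ext (by omega))

theorem sum_eq_zero_of_mate (P : Diagram m n) (u : Point m n → ZMod 2)
    (hu : ∀ p, u (P.mate p) = u p) : ∑ p, u p = 0 :=
  Finset.sum_involution (fun p _ => P.mate p)
    (fun p _ => by rw [hu]; exact CharTwo.add_self_eq_zero _)
    (fun p _ _ => P.mate_ne p) (fun _ _ => Finset.mem_univ _) (fun p _ => P.mate_mate p)

theorem sum_eq_sum_arcs {M : Type*} [AddCommMonoid M] (P : Diagram m n) (f : Point m n → M) :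
    ∑ p, f p = ∑ p with pos p < pos (P.mate p), (f p + f (P.mate p)) := by
  rw [Finset.sum_add_distrib, ← Finset.sum_filter_add_sum_filter_not Finset.univ
    (fun p => pos p < pos (P.mate p))]
  have hne (p : Point m n) : pos p ≠ pos (P.mate p) := fun h => P.mate_ne p (pos_injective h).symm
  have mem_iff (p : Point m n) :
      ¬ pos p < pos (P.mate p) ↔ pos (P.mate p) < pos (P.mate (P.mate p)) := by
    have := hne p
    rw [P.mate_mate]
    omega
  congr 1
  refine Finset.sum_equiv (Function.Involutive.toPerm P.mate P.mate_mate) (fun p => ?_)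
    fun p _ => ?_
  · simp only [Finset.mem_filter_univ]
    exact mem_iff p
  · exact congrArg f (P.mate_mate p).symm

/-- The parity of the number of pairs of a point of `u` and a point of `v` that are related by `r`,
for two sets given by their indicator functions. -/
def pairing {ι : Type*} [Fintype ι] (r : ι → ι → Prop) [DecidableRel r] (u v : ι → ZMod 2) :
    ZMod 2 :=
  ∑ p, ∑ q, if r p q then u p * v q else 0

theorem pairing_lt_add_pairing_gt {ι : Type*} [Fintype ι] [LinearOrder ι] {u v : ι → ZMod 2}
    (h : ∀ i, u i * v i = 0) :
    pairing (· < ·) u v + pairing (· > ·) u v = (∑ i, u i) * ∑ j, v j := by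
  simp only [pairing, ← Finset.sum_add_distrib, Finset.sum_mul_sum]
  refine Finset.sum_congr rfl fun i _ => Finset.sum_congr rfl fun j _ => ?_
  rcases lt_trichotomy i j with hij | rfl | hij
  · simp [hij, hij.le]
  · simp [h]
  · simp [hij, hij.le]

theorem pairing_pair_pair {ι : Type*} [Fintype ι] [DecidableEq ι] (r : ι → ι → Prop)
    [DecidableRel r] (p p' q q' : ι) :
    pairing r (Pi.single p 1 + Pi.single p' 1) (Pi.single q 1 + Pi.single q' 1) =
      (if r p q then 1 else 0) + (if r p q' then 1 else 0) + (if r p' q then 1 else 0) +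
        if r p' q' then 1 else 0 := by
  have sum_single (p q : ι) :
      ∑ x, ∑ y, (if r x y then (Pi.single p 1 : ι → ZMod 2) x * (Pi.single q 1 : ι → ZMod 2) y
        else 0) = if r p q then 1 else 0 := by
    rw [Finset.sum_eq_single p, Finset.sum_eq_single q] <;> simp +contextual
  simp only [pairing, Pi.add_apply, add_mul, mul_add, ite_add_zero, Finset.sum_add_distrib,
    sum_single]
  ring

theorem interlacing_sum_eq_zero {a a' b b' : ℕ} (ha : a < a') (hb : b < b') (hab : a ≠ b)
    (hab' : a ≠ b') (ha'b : a' ≠ b) (ha'b' : a' ≠ b') (h₁ : ¬ (a < b ∧ b < a' ∧ a' < b'))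
    (h₂ : ¬ (b < a ∧ a < b' ∧ b' < a')) :
    (if a < b then 1 else 0) + (if a < b' then 1 else 0) + (if a' < b then 1 else 0) +
      (if a' < b' then 1 else 0) = (0 : ZMod 2) := by
  split_ifs <;> first | omega | decide

theorem pairing_eq_zero_of_mate (P : Diagram m n) {u v : Point m n → ZMod 2}
    (hu : ∀ p, u (P.mate p) = u p) (hv : ∀ p, v (P.mate p) = v p) (huv : ∀ p, u p * v p = 0) :
    pairing (pos · < pos ·) u v = 0 := by
  rw [pairing, sum_eq_sum_arcs P]
  refine Finset.sum_eq_zero fun p hp => ?_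
  rw [← Finset.sum_add_distrib, sum_eq_sum_arcs P]
  refine Finset.sum_eq_zero fun q hq => ?_
  rw [Finset.mem_filter_univ] at hp hq
  have ite_eq_mul_ite (r : Prop) [Decidable r] :
      (if r then u p * v q else 0) = u p * v q * if r then 1 else 0 := (mul_boole r _).symm
  by_cases h0 : u p * v q = 0
  · simp only [hu, hv, h0, ite_self, add_zero]
  have ne₁ : p ≠ q := by rintro rfl; exact h0 (huv _)
  have ne₂ : P.mate p ≠ q := by rintro rfl; exact h0 (by rw [hv]; exact huv _)
  have ne₃ : p ≠ P.mate q := by rintro rfl; exact ne₂ (P.mate_mate q)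
  have ne₄ : P.mate p ≠ P.mate q := fun h => ne₁ (by rw [← P.mate_mate p, h, P.mate_mate])
  have key := interlacing_sum_eq_zero hp hq (pos_injective.ne ne₁) (pos_injective.ne ne₃)
    (pos_injective.ne ne₂) (pos_injective.ne ne₄) (P.noncrossing p q) (P.noncrossing q p)
  simp only [hu, hv, ite_eq_mul_ite]
  linear_combination u p * v q * key

theorem pairing_elim (u₁ v₁ : Fin m → ZMod 2) (u₂ v₂ : Fin n → ZMod 2) :
    pairing (pos · < pos ·) (Sum.elim u₁ u₂) (Sum.elim v₁ v₂) =
      pairing (· < ·) u₁ v₁ + (∑ i, u₁ i) * (∑ j, v₂ j) + pairing (· > ·) u₂ v₂ := by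
  have top_lt_bottom (i : Fin m) (j : Fin n) : (i : ℕ) < m + n - 1 - j := by omega
  have not_bottom_lt_top (i : Fin m) (j : Fin n) : ¬ (m + n - 1 - j < (i : ℕ)) := by omega
  have bottom_lt_bottom (i j : Fin n) : m + n - 1 - i < m + n - 1 - (j : ℕ) ↔ i > j := by
    rw [gt_iff_lt, Fin.lt_def]; omega
  simp only [pairing, Fintype.sum_sum_type, pos, Sum.elim_inl, Sum.elim_inr, top_lt_bottom,
    not_bottom_lt_top, bottom_lt_bottom, if_true, if_false, Finset.sum_const_zero,
    Finset.sum_add_distrib, Fin.val_fin_lt, Finset.sum_mul_sum]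
  ring

theorem pairing_elim_trans {u₁ v₁ : Fin m → ZMod 2} {u₂ v₂ : Fin n → ZMod 2}
    {u₃ v₃ : Fin k → ZMod 2} (hu : ∑ i, u₁ i = ∑ i, u₂ i) (hv : ∑ i, v₂ i = ∑ i, v₃ i)
    (huv : ∀ i, u₂ i * v₂ i = 0)
    (h₁₂ : pairing (pos · < pos ·) (Sum.elim u₁ u₂) (Sum.elim v₁ v₂) = 0)
    (h₂₃ : pairing (pos · < pos ·) (Sum.elim u₂ u₃) (Sum.elim v₂ v₃) = 0) :
    pairing (pos · < pos ·) (Sum.elim u₁ u₃) (Sum.elim v₁ v₃) = 0 := by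
  have h₂ := pairing_lt_add_pairing_gt huv
  rw [pairing_elim] at h₁₂ h₂₃ ⊢
  rw [hu] at h₁₂ ⊢
  rw [← hv] at h₂₃ ⊢
  have two : (2 : ZMod 2) = 0 := rfl
  linear_combination h₁₂ + h₂₃ - h₂ - (∑ i, u₂ i) * (∑ i, v₂ i) * two

theorem pairing_outerCurve_eq_zero (P : Diagram m n) (Q : Diagram n k)
    {f g : StackCurve P Q → ZMod 2} (hfg : ∀ c, f c * g c = 0) :
    pairing (pos · < pos ·) (f ∘ outerCurve P Q) (g ∘ outerCurve P Q) = 0 := by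
  let top (f : StackCurve P Q → ZMod 2) (i : Fin m) := f (Quot.mk _ (.inl (.inl i)))
  let mid (f : StackCurve P Q → ZMod 2) (i : Fin n) := f (Quot.mk _ (.inl (.inr i)))
  let bot (f : StackCurve P Q → ZMod 2) (i : Fin k) := f (Quot.mk _ (.inr (.inr i)))
  have upper_mate (f : StackCurve P Q → ZMod 2) (p : Point m n) :
      Sum.elim (top f) (mid f) (P.mate p) = Sum.elim (top f) (mid f) p := by
    have : Sum.elim (top f) (mid f) = fun p => f (Quot.mk _ (.inl p)) := by
      funext p; rcases p with p | p <;> rfl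
    rw [this]
    exact congrArg f (Quot.sound (StackAdj.upper p)).symm
  have lower_mate (f : StackCurve P Q → ZMod 2) (p : Point n k) :
      Sum.elim (mid f) (bot f) (Q.mate p) = Sum.elim (mid f) (bot f) p := by
    have : Sum.elim (mid f) (bot f) = fun p => f (Quot.mk _ (.inr p)) := by
      funext p
      rcases p with i | i
      · exact congrArg f (Quot.sound (StackAdj.middle i))
      · rfl
    rw [this]
    exact congrArg f (Quot.sound (StackAdj.lower p)).symm
  have sum_top : ∑ i, top f i = ∑ i, mid f i := by
    have := sum_eq_zero_of_mate P _ (upper_mate f)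
    rwa [Fintype.sum_sum_type, CharTwo.add_eq_zero] at this
  have sum_bot : ∑ i, mid g i = ∑ i, bot g i := by
    have := sum_eq_zero_of_mate Q _ (lower_mate g)
    rwa [Fintype.sum_sum_type, CharTwo.add_eq_zero] at this
  have outer (f : StackCurve P Q → ZMod 2) : f ∘ outerCurve P Q = Sum.elim (top f) (bot f) := by
    funext p; rcases p with p | p <;> rfl
  rw [outer, outer]
  exact pairing_elim_trans sum_top sum_bot (fun _ => hfg _)
    (pairing_eq_zero_of_mate P (upper_mate f) (upper_mate g)
      (by rintro (i | i) <;> exact hfg _))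
    (pairing_eq_zero_of_mate Q (lower_mate f) (lower_mate g)
      (by rintro (i | i) <;> exact hfg _))

/-- If the two curves crossed on the boundary, their sets of endpoints would pair to `1`. -/
theorem outerCurve_noncrossing (P : Diagram m n) (Q : Diagram n k) {p p' q q' : Point m k}
    (hp : ∀ r, outerCurve P Q r = outerCurve P Q p ↔ r = p ∨ r = p')
    (hq : ∀ r, outerCurve P Q r = outerCurve P Q q ↔ r = q ∨ r = q') :
    ¬ (pos p < pos q ∧ pos q < pos p' ∧ pos p' < pos q') := by
  classical
  rintro ⟨hpq, hqp', hpq'⟩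
  have hne : outerCurve P Q p ≠ outerCurve P Q q := by
    intro h
    rcases (hp q).1 h.symm with rfl | rfl <;> omega
  have indicator {r r' : Point m k} (hr : r ≠ r')
      (h : ∀ s, outerCurve P Q s = outerCurve P Q r ↔ s = r ∨ s = r') :
      (Pi.single (outerCurve P Q r) 1 : StackCurve P Q → ZMod 2) ∘ outerCurve P Q =
        Pi.single r 1 + Pi.single r' 1 := by
    funext s
    simp only [Function.comp_apply, Pi.add_apply, Pi.single_apply, h]
    by_cases hsr : s = r
    · simp [hsr, hr]
    · simp [hsr]
  have hzero := pairing_outerCurve_eq_zero P Q (f := Pi.single (outerCurve P Q p) 1)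
    (g := Pi.single (outerCurve P Q q) 1) fun c => by
      by_cases hc : c = outerCurve P Q p
      · simp [hc, hne]
      · simp [hc]
  rw [indicator (by rintro rfl; omega) hp, indicator (by rintro rfl; omega) hq, pairing_pair_pair,
    if_pos hpq, if_pos (by omega), if_neg (by omega), if_pos hpq'] at hzero
  exact absurd hzero (by decide)

theorem exists_isStack (P : Diagram m n) (Q : Diagram n k) : ∃ R, IsStack P Q R := by
  choose f hf huniq using existsUnique_other_end P Q
  have hiff (p r) : outerCurve P Q r = outerCurve P Q p ↔ r = p ∨ r = f p := by
    constructor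
    · exact fun h => or_iff_not_imp_left.2 fun hne => huniq p r ⟨hne, h⟩
    · rintro (rfl | rfl)
      · rfl
      · exact (hf p).2
  have involutive (p) : f (f p) = p :=
    ((hiff p (f (f p))).1 ((hf _).2.trans (hf p).2)).resolve_right (hf _).1
  exact ⟨⟨f, involutive, fun p => (hf p).1,
    fun p q => outerCurve_noncrossing P Q (hiff p) (hiff q)⟩, fun p => (hf p).2⟩

/-- The crossingless connection that remains of a stack when its circles are removed. -/
def stack (P : Diagram m n) (Q : Diagram n k) : Diagram m k := (exists_isStack P Q).choose

theorem isStack_stack (P : Diagram m n) (Q : Diagram n k) : IsStack P Q (stack P Q) :=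
  (exists_isStack P Q).choose_spec

theorem isStack_iff {P : Diagram m n} {Q : Diagram n k} {R : Diagram m k} :
    IsStack P Q R ↔ R = stack P Q :=
  ⟨fun h => h.unique (isStack_stack _ _), fun h => h ▸ isStack_stack _ _⟩

/-! ### Color matrices -/

variable {C : Type*}

/-- The coloring `s` of the boundary points is constant on the arcs of `P`. -/
def Diagram.Fits (P : Diagram m n) (s : Point m n → C) : Prop := ∀ p, s (P.mate p) = s p

theorem Diagram.Fits.eq_of_mate_eq {P : Diagram m n} {s : Point m n → C} (hs : P.Fits s)
    {p q : Point m n} (h : P.mate p = q) : s p = s q := by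
  rw [← h, hs p]

open Classical in
/-- The matrix of a crossingless connection, indexed by the colorings of the top and the bottom
edge with colors in `C`: an entry is `1` if the coloring of the boundary is constant on the arcs,
otherwise `0`. -/
def colorMatrix (C : Type*) (P : Diagram m n) : Matrix (Fin m → C) (Fin n → C) ℤ :=
  Matrix.of fun σ τ => if P.Fits (Sum.elim σ τ) then 1 else 0

theorem colorMatrix_apply_of_fits {P : Diagram m n} {σ : Fin m → C} {τ : Fin n → C}
    (h : P.Fits (Sum.elim σ τ)) : colorMatrix C P σ τ = 1 :=
  if_pos h

theorem colorMatrix_apply_of_not_fits {P : Diagram m n} {σ : Fin m → C} {τ : Fin n → C}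
    (h : ¬ P.Fits (Sum.elim σ τ)) : colorMatrix C P σ τ = 0 :=
  if_neg h

theorem fits_const (P : Diagram m n) (c : C) : P.Fits (Sum.elim (fun _ => c) fun _ => c) := by
  have h := Sum.elim_const_const (α := Fin m) (β := Fin n) c
  exact fun p => (congrFun h (P.mate p)).trans (congrFun h p).symm

theorem Diagram.Fits.recolor_arc [DecidableEq (Point m n)] {P : Diagram m n} {s : Point m n → C}
    (hs : P.Fits s) (p : Point m n) (c : C) :
    P.Fits fun q => if q = p ∨ q = P.mate p then c else s q := by
  have mate_eq_iff (q r : Point m n) : P.mate q = r ↔ q = P.mate r :=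
    ⟨fun h => by rw [← h, P.mate_mate], fun h => by rw [h, P.mate_mate]⟩
  intro q
  simp only [mate_eq_iff, P.mate_mate, or_comm, hs q]

theorem colorMatrix_injective [Nontrivial C] :
    Function.Injective (colorMatrix C : Diagram m n → _) := by
  classical
  intro P Q hPQ
  ext1
  funext p
  by_contra hp
  obtain ⟨c, c', hc⟩ := exists_pair_ne C
  let s : Point m n → C := fun q => if q = p ∨ q = P.mate p then c else c'
  have hs : s = Sum.elim (s ∘ Sum.inl) (s ∘ Sum.inr) := (Sum.elim_comp_inl_inr s).symm
  have hP : P.Fits s := Diagram.Fits.recolor_arc (s := fun _ => c') (fun _ => rfl) p c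
  have hQ : ¬ Q.Fits s := by
    intro hQ
    have hsQ : s (Q.mate p) = c' := if_neg (not_or.2 ⟨Q.mate_ne p, Ne.symm hp⟩)
    have hsp : s p = c := if_pos (Or.inl rfl)
    exact hc (hsp.symm.trans ((hQ p).symm.trans hsQ))
  have := congrFun (congrFun hPQ (s ∘ Sum.inl)) (s ∘ Sum.inr)
  rw [hs] at hP hQ
  rw [colorMatrix_apply_of_fits hP, colorMatrix_apply_of_not_fits hQ] at this
  exact one_ne_zero this

theorem eq_of_smul_colorMatrix_eq [Fintype C] [Nontrivial C] {P Q : Diagram m n} {a b : ℕ}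
    (h : (Fintype.card C : ℤ) ^ a • colorMatrix C P = (Fintype.card C : ℤ) ^ b • colorMatrix C Q) :
    a = b ∧ P = Q := by
  have one_lt : 1 < Fintype.card C := Fintype.one_lt_card
  have hab : a = b := by
    obtain ⟨c⟩ : Nonempty C := inferInstance
    have := congrFun (congrFun h fun _ => c) fun _ => c
    rw [Matrix.smul_apply, Matrix.smul_apply, colorMatrix_apply_of_fits (fits_const P c),
      colorMatrix_apply_of_fits (fits_const Q c), smul_eq_mul, smul_eq_mul, mul_one,
      mul_one] at this
    exact Nat.pow_right_injective one_lt (by exact_mod_cast this)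
  subst hab
  have hne : (Fintype.card C : ℤ) ^ a ≠ 0 := pow_ne_zero a (by exact_mod_cast by omega)
  exact ⟨rfl, colorMatrix_injective (smul_right_injective _ hne h)⟩

theorem card_extensions {X Y : Type*} [Finite Y] (o : X → Y) (s : X → C)
    (hs : s.FactorsThrough o) :
    Nat.card {f : Y → C // f ∘ o = s} = Nat.card C ^ Nat.card {y : Y // ∀ p, y ≠ o p} := by
  classical
  let e : {f : Y → C // f ∘ o = s} ≃ ({y : Y // ∀ p, y ≠ o p} → C) :=
    { toFun := fun f y => f.1 y.1
      invFun := fun g => ⟨fun y => if h : ∀ p, y ≠ o p then g ⟨y, h⟩ else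
          s (not_forall_not.1 h).choose, funext fun p => by
          have h : ¬ ∀ q, o p ≠ o q := fun h => h p rfl
          simp only [Function.comp_apply, dif_neg h]
          exact hs (not_forall_not.1 h).choose_spec.symm⟩
      left_inv := by
        rintro ⟨f, rfl⟩
        refine Subtype.ext (funext fun y => ?_)
        by_cases h : ∀ p, y ≠ o p
        · simp only [dif_pos h]
        · simp only [dif_neg h]
          exact congrArg f (not_forall_not.1 h).choose_spec.symm
      right_inv := fun g => funext fun y => by simp only [dif_pos y.2] }
  rw [Nat.card_congr e, Nat.card_fun]

/-- Colorings of the curves of a stack are colorings of the two diagrams that agree on the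
middle line. -/
def curveColoringEquiv (P : Diagram m n) (Q : Diagram n k) (σ : Fin m → C) (τ : Fin k → C) :
    {f : StackCurve P Q → C // f ∘ outerCurve P Q = Sum.elim σ τ} ≃
      {μ : Fin n → C // P.Fits (Sum.elim σ μ) ∧ Q.Fits (Sum.elim μ τ)} where
  toFun f := ⟨fun i => f.1 (Quot.mk _ (Sum.inl (Sum.inr i))), by
    obtain ⟨f, hf⟩ := f
    have upper : (Sum.elim σ fun i => f (Quot.mk _ (Sum.inl (Sum.inr i)))) =
        fun p : Point m n => f (Quot.mk _ (Sum.inl p)) := by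
      funext p
      rcases p with i | i
      · exact (congrFun hf (Sum.inl i)).symm
      · rfl
    have lower : (Sum.elim (fun i => f (Quot.mk _ (Sum.inl (Sum.inr i)))) τ) =
        fun p : Point n k => f (Quot.mk _ (Sum.inr p)) := by
      funext p
      rcases p with i | i
      · exact congrArg f (Quot.sound (StackAdj.middle i))
      · exact (congrFun hf (Sum.inr i)).symm
    simp only [upper, lower]
    exact ⟨fun p => congrArg f (Quot.sound (StackAdj.upper p)).symm,
      fun p => congrArg f (Quot.sound (StackAdj.lower p)).symm⟩⟩
  invFun μ := ⟨Quot.lift (Sum.elim (Sum.elim σ μ.1) (Sum.elim μ.1 τ)) (by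
      intro x y h
      induction h with
      | upper p => exact (μ.2.1 p).symm
      | lower p => exact (μ.2.2 p).symm
      | middle i => rfl), by funext p; rcases p with i | i <;> rfl⟩
  left_inv := by
    rintro ⟨f, hf⟩
    refine Subtype.ext (funext (Quot.ind ?_))
    rintro ((i | i) | (i | i))
    · exact (congrFun hf (Sum.inl i)).symm
    · rfl
    · exact congrArg f (Quot.sound (StackAdj.middle i))
    · exact (congrFun hf (Sum.inr i)).symm
  right_inv _ := rfl

theorem colorMatrix_mul_apply [Fintype C] (P : Diagram m n) (Q : Diagram n k) (σ : Fin m → C)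
    (τ : Fin k → C) : (colorMatrix C P * colorMatrix C Q) σ τ =
      Nat.card {f : StackCurve P Q → C // f ∘ outerCurve P Q = Sum.elim σ τ} := by
  classical
  rw [Nat.card_congr (curveColoringEquiv P Q σ τ), Nat.card_eq_fintype_card,
    Fintype.card_subtype, Finset.card_filter]
  push_cast
  simp only [Matrix.mul_apply, colorMatrix, Matrix.of_apply, ite_and, ite_mul, one_mul, zero_mul]

theorem colorMatrix_mul [Fintype C] (P : Diagram m n) (Q : Diagram n k) :
    colorMatrix C P * colorMatrix C Q =
      (Fintype.card C : ℤ) ^ stackCircles P Q • colorMatrix C (stack P Q) := by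
  have hPQ := isStack_stack P Q
  ext σ τ
  rw [colorMatrix_mul_apply, Matrix.smul_apply]
  by_cases hfit : (stack P Q).Fits (Sum.elim σ τ)
  · have hs : (Sum.elim σ τ).FactorsThrough (outerCurve P Q) := by
      intro p q hpq
      rcases hPQ.outerCurve_eq_iff.1 hpq with rfl | rfl
      · rfl
      · exact hfit q
    rw [colorMatrix_apply_of_fits hfit, card_extensions _ _ hs, Nat.card_eq_fintype_card,
      Nat.cast_pow, smul_eq_mul, mul_one, stackCircles]
  · have hempty : IsEmpty {f : StackCurve P Q → C // f ∘ outerCurve P Q = Sum.elim σ τ} :=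
      ⟨fun f => hfit fun p => by rw [← f.2]; exact congrArg f.1 (hPQ p)⟩
    rw [colorMatrix_apply_of_not_fits hfit, Nat.card_of_isEmpty, smul_zero, Nat.cast_zero]

theorem stack_eq_of_colorMatrix_mul (C : Type*) [Fintype C] [Nontrivial C] {P : Diagram m n}
    {Q : Diagram n k} {R : Diagram m k} {a : ℕ}
    (h : colorMatrix C P * colorMatrix C Q = (Fintype.card C : ℤ) ^ a • colorMatrix C R) :
    stackCircles P Q = a ∧ stack P Q = R := by
  rw [colorMatrix_mul] at h
  exact eq_of_smul_colorMatrix_eq h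

theorem stack_assoc (P : Diagram m n) (Q : Diagram n k) (R : Diagram k l) :
    stackCircles P Q + stackCircles (stack P Q) R = stackCircles Q R + stackCircles P (stack Q R) ∧
      stack (stack P Q) R = stack P (stack Q R) := by
  apply eq_of_smul_colorMatrix_eq (C := Bool)
  have := Matrix.mul_assoc (colorMatrix Bool P) (colorMatrix Bool Q) (colorMatrix Bool R)
  rwa [colorMatrix_mul, colorMatrix_mul, Matrix.smul_mul, Matrix.mul_smul, colorMatrix_mul,
    colorMatrix_mul, smul_smul, smul_smul, ← pow_add, ← pow_add] at this

/-! ### The product -/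

open Classical in
/-- The basis vector of a crossingless connection. -/
def single (P : Diagram m n) : TL m n := Pi.single P 1

theorem ext_single {V : Type*} [AddCommMonoid V] [Module K V] {f g : TL m n →ₗ[K] V}
    (h : ∀ P, f (single P) = g (single P)) : f = g := by
  classical
  refine LinearMap.pi_ext' fun P => LinearMap.ext_ring ?_
  simpa [single] using h P

theorem ext_single₂ {V : Type*} [AddCommMonoid V] [Module K V]
    {f g : TL m n →ₗ[K] TL k l →ₗ[K] V}
    (h : ∀ P Q, f (single P) (single Q) = g (single P) (single Q)) : f = g :=
  ext_single fun P => ext_single fun Q => h P Q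

/-- The product as a bilinear map. -/
def compₗ : TL m n →ₗ[K] TL n k →ₗ[K] TL m k :=
  LinearMap.mk₂ K comp
    (fun x x' y => by
      funext R
      simp only [comp, Pi.add_apply, ← Finset.sum_add_distrib]
      exact Finset.sum_congr rfl fun P _ => Finset.sum_congr rfl fun Q _ => by split_ifs <;> ring)
    (fun c x y => by
      funext R
      simp only [comp, Pi.smul_apply, smul_eq_mul, Finset.mul_sum]
      exact Finset.sum_congr rfl fun P _ => Finset.sum_congr rfl fun Q _ => by split_ifs <;> ring)
    (fun x y y' => by
      funext R
      simp only [comp, Pi.add_apply, ← Finset.sum_add_distrib]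
      exact Finset.sum_congr rfl fun P _ => Finset.sum_congr rfl fun Q _ => by split_ifs <;> ring)
    (fun c x y => by
      funext R
      simp only [comp, Pi.smul_apply, smul_eq_mul, Finset.mul_sum]
      exact Finset.sum_congr rfl fun P _ => Finset.sum_congr rfl fun Q _ => by split_ifs <;> ring)

theorem compₗ_apply (x : TL m n) (y : TL n k) : compₗ x y = comp x y := rfl

theorem comp_zero (x : TL m n) : comp x (0 : TL n k) = 0 := (compₗ x).map_zero

theorem zero_comp (y : TL n k) : comp (0 : TL m n) y = 0 := (compₗ.flip y).map_zero

theorem comp_smul (c : K) (x : TL m n) (y : TL n k) : comp x (c • y) = c • comp x y :=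
  (compₗ x).map_smul c y

theorem smul_comp (c : K) (x : TL m n) (y : TL n k) : comp (c • x) y = c • comp x y :=
  (compₗ.flip y).map_smul c x

theorem single_comp_single (P : Diagram m n) (Q : Diagram n k) :
    comp (single P) (single Q) = d ^ stackCircles P Q • single (stack P Q) := by
  classical
  funext R
  rw [comp, Finset.sum_eq_single P, Finset.sum_eq_single Q]
  · simp [single, isStack_iff, Pi.single_apply]
  · intro Q' _ h; simp [single, h]
  · simp
  · intro P' _ h; simp [single, h]
  · simp

theorem single_comp_single_eq_of_colorMatrix (C : Type*) [Fintype C] [Nontrivial C]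
    {P : Diagram m n} {Q : Diagram n k} {R : Diagram m k} {a : ℕ}
    (h : colorMatrix C P * colorMatrix C Q = (Fintype.card C : ℤ) ^ a • colorMatrix C R) :
    comp (single P) (single Q) = d ^ a • single R := by
  obtain ⟨hcircles, hstack⟩ := stack_eq_of_colorMatrix_mul C h
  rw [single_comp_single, hcircles, hstack]

theorem comp_assoc (x : TL m n) (y : TL n k) (z : TL k l) :
    comp (comp x y) z = comp x (comp y z) := by
  have : compₗ.compr₂ (compₗ (m := m) (n := k) (k := l)) =
      (LinearMap.llcomp K _ _ _ ∘ₗ compₗ).compl₂ (compₗ (m := n) (n := k) (k := l)) := by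
    refine ext_single₂ fun P Q => ext_single fun R => ?_
    change comp (comp (single P) (single Q)) (single R) =
      comp (single P) (comp (single Q) (single R))
    simp only [single_comp_single, comp_smul, smul_comp, smul_smul, ← pow_add]
    rw [(stack_assoc P Q R).1, (stack_assoc P Q R).2]
  exact LinearMap.congr_fun (LinearMap.congr_fun (LinearMap.congr_fun this x) y) z

/-! ### Reflection -/

theorem Diagram.reflect_reflect (P : Diagram m n) : P.reflect.reflect = P := by
  ext p
  simp [Diagram.reflect]

theorem reflect_reflect (x : TL m n) : reflect (reflect x) = x :=
  funext fun P => congrArg x P.reflect_reflect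

theorem reflect_single (P : Diagram m n) : reflect (single P) = single P.reflect := by
  classical
  funext Q
  have : Q.reflect = P ↔ Q = P.reflect :=
    ⟨fun h => by rw [← h, Diagram.reflect_reflect], fun h => by rw [h, Diagram.reflect_reflect]⟩
  simp only [reflect, single, Pi.single_apply, this]

/-- The reflection as a linear map. -/
def reflectₗ : TL m n →ₗ[K] TL n m where
  toFun := reflect
  map_add' _ _ := rfl
  map_smul' _ _ := rfl

theorem reflect_smul (c : K) (x : TL m n) : reflect (c • x) = c • reflect x := rfl

theorem reflect_zero : reflect (0 : TL m n) = 0 := rfl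

theorem colorMatrix_reflect (P : Diagram m n) :
    colorMatrix C P.reflect = (colorMatrix C P).transpose := by
  ext σ τ
  have elim_swap (p : Point n m) : Sum.elim σ τ p = Sum.elim τ σ p.swap := by
    rcases p with p | p <;> rfl
  have : P.reflect.Fits (Sum.elim σ τ) ↔ P.Fits (Sum.elim τ σ) := by
    simp only [Diagram.Fits, Diagram.reflect, elim_swap, Sum.swap_swap]
    exact ⟨fun h p => by simpa using h p.swap, fun h p => h p.swap⟩
  classical exact if_congr this rfl rfl

theorem reflect_comp (x : TL m n) (y : TL n k) :
    reflect (comp x y) = comp (reflect y) (reflect x) := by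
  have : (compₗ (m := m) (n := n) (k := k)).compr₂ reflectₗ =
      ((compₗ (m := k) (n := n) (k := m)).flip.compl₂ reflectₗ) ∘ₗ reflectₗ := by
    refine ext_single₂ fun P Q => ?_
    change reflect (comp (single P) (single Q)) = comp (reflect (single Q)) (reflect (single P))
    rw [single_comp_single, reflect_smul, reflect_single, reflect_single, reflect_single,
      single_comp_single_eq_of_colorMatrix Bool]
    rw [colorMatrix_reflect, colorMatrix_reflect, ← Matrix.transpose_mul, colorMatrix_mul,
      Matrix.transpose_smul, colorMatrix_reflect]
  exact LinearMap.congr_fun (LinearMap.congr_fun this x) y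

/-! ### Strands added on the left -/

/-- The inclusion of the marked points when a strand is added on the left. -/
abbrev shift (p : Point m n) : Point (m + 1) (n + 1) := Sum.map Fin.succ Fin.succ p

theorem shift_injective : Function.Injective (shift : Point m n → _) :=
  (Fin.succ_injective _).sumMap (Fin.succ_injective _)

theorem forall_point_succ {r : Point (m + 1) (n + 1) → Prop} :
    (∀ p, r p) ↔ r (Sum.inl 0) ∧ r (Sum.inr 0) ∧ ∀ p, r (shift p) := by
  simp only [Sum.forall, Fin.forall_fin_succ, Sum.map_inl, Sum.map_inr]
  tauto

theorem pos_inr_zero : pos (Sum.inr 0 : Point m (n + 1)) = m + n := rfl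

theorem pos_shift (p : Point m n) : pos (shift p) = pos p + 1 := by
  rcases p with p | p
  · rfl
  · have := p.isLt
    simp only [pos, Sum.map_inr, Fin.val_succ]
    omega

theorem pos_lt (p : Point m n) : pos p < m + n := by
  have := pos_swap p
  omega

/-- The arcs after a vertical strand is added on the left. -/
def addLeftMate (f : Point m n → Point m n) : Point (m + 1) (n + 1) → Point (m + 1) (n + 1) :=
  Sum.elim (Fin.cases (Sum.inr 0) fun i => shift (f (Sum.inl i)))
    (Fin.cases (Sum.inl 0) fun i => shift (f (Sum.inr i)))

theorem addLeftMate_inl_zero (f : Point m n → Point m n) :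
    addLeftMate f (Sum.inl 0) = Sum.inr 0 := rfl

theorem addLeftMate_inr_zero (f : Point m n → Point m n) :
    addLeftMate f (Sum.inr 0) = Sum.inl 0 := rfl

theorem addLeftMate_shift (f : Point m n → Point m n) (p : Point m n) :
    addLeftMate f (shift p) = shift (f p) := by
  rcases p with p | p <;> rfl

/-- A crossingless connection with a vertical strand added on the left. -/
def Diagram.addLeft (P : Diagram m n) : Diagram (m + 1) (n + 1) where
  mate := addLeftMate P.mate
  mate_mate := forall_point_succ.2 ⟨rfl, rfl, fun p => by
    rw [addLeftMate_shift, addLeftMate_shift, P.mate_mate]⟩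
  mate_ne := forall_point_succ.2 ⟨Sum.inr_ne_inl, Sum.inl_ne_inr, fun p => by
    rw [addLeftMate_shift]
    exact shift_injective.ne (P.mate_ne p)⟩
  noncrossing p q := by
    have pos_inl_zero : pos (Sum.inl 0 : Point (m + 1) (n + 1)) = 0 := rfl
    have hp := pos_lt (addLeftMate P.mate p)
    have hq := pos_lt (addLeftMate P.mate q)
    revert p q
    rw [forall_point_succ]
    refine ⟨fun q _ hq => ?_, fun q _ _ => ?_, fun p => forall_point_succ.2 ⟨?_, ?_, fun q => ?_⟩⟩
    · rw [addLeftMate_inl_zero, pos_inr_zero]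
      omega
    · rw [addLeftMate_inr_zero, pos_inl_zero]
      omega
    · rw [pos_inl_zero]
      omega
    · rw [addLeftMate_inr_zero, pos_inl_zero]
      omega
    · simp only [addLeftMate_shift, pos_shift]
      have := P.noncrossing p q
      omega

theorem eq_addLeft_iff {P : Diagram m n} {Q : Diagram (m + 1) (n + 1)} :
    Q = P.addLeft ↔
      Q.mate (Sum.inl 0) = Sum.inr 0 ∧ ∀ p, Q.mate (shift p) = shift (P.mate p) := by
  constructor
  · rintro rfl
    exact ⟨rfl, addLeftMate_shift _⟩
  · rintro ⟨h0, hshift⟩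
    ext1
    refine funext (forall_point_succ.2 ⟨h0, ?_, fun p => ?_⟩)
    · rw [← h0, Q.mate_mate, h0]
      rfl
    · exact (hshift p).trans (addLeftMate_shift _ p).symm

/-- The addition of a strand as a linear map. -/
def addLeftₗ : TL m n →ₗ[K] TL (m + 1) (n + 1) where
  toFun := addLeft
  map_add' x y := by
    funext Q
    simp only [addLeft, Pi.add_apply, ← Finset.sum_add_distrib, ite_add_zero]
  map_smul' c x := by
    funext Q
    simp only [addLeft, Pi.smul_apply, smul_eq_mul, Finset.mul_sum, mul_ite, mul_zero,
      RingHom.id_apply]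

theorem addLeft_zero : addLeft (0 : TL m n) = 0 := addLeftₗ.map_zero

theorem addLeft_smul (c : K) (x : TL m n) : addLeft (c • x) = c • addLeft x :=
  addLeftₗ.map_smul c x

theorem addLeft_single (P : Diagram m n) : addLeft (single P) = single P.addLeft := by
  classical
  funext Q
  simp only [addLeft, ← eq_addLeft_iff]
  rw [Finset.sum_eq_single P]
  · simp [single, Pi.single_apply]
  · intro P' _ h; simp [single, h]
  · simp

theorem Diagram.reflect_addLeft (P : Diagram m n) : P.addLeft.reflect = P.reflect.addLeft := by
  refine eq_addLeft_iff.2 ⟨rfl, fun p => ?_⟩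
  have swap_shift {a b : ℕ} (q : Point a b) : (shift q).swap = shift q.swap := by
    rcases q with q | q <;> rfl
  calc (addLeftMate P.mate (shift p).swap).swap = (shift (P.mate p.swap)).swap := by
        rw [swap_shift, addLeftMate_shift]
    _ = shift (P.mate p.swap).swap := swap_shift _

theorem reflect_addLeft (x : TL m n) : reflect (addLeft x) = addLeft (reflect x) := by
  have : reflectₗ ∘ₗ (addLeftₗ : TL m n →ₗ[K] _) = addLeftₗ ∘ₗ reflectₗ := by
    refine ext_single fun P => ?_
    change reflect (addLeft (single P)) = addLeft (reflect (single P))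
    rw [addLeft_single, reflect_single, reflect_single, addLeft_single, P.reflect_addLeft]
  exact LinearMap.congr_fun this x

theorem fits_addLeft_iff (P : Diagram m n) (c c' : C) (σ : Fin m → C) (τ : Fin n → C) :
    P.addLeft.Fits (Sum.elim (Fin.cons c σ : Fin (m + 1) → C) (Fin.cons c' τ : Fin (n + 1) → C)) ↔
      c = c' ∧ P.Fits (Sum.elim σ τ) := by
  set s := Sum.elim (Fin.cons c σ : Fin (m + 1) → C) (Fin.cons c' τ : Fin (n + 1) → C)
  have s_shift (p : Point m n) : s (shift p) = Sum.elim σ τ p := by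
    rcases p with p | p <;> rfl
  have mate_shift : ∀ p, P.addLeft.mate (shift p) = shift (P.mate p) := addLeftMate_shift _
  rw [Diagram.Fits, forall_point_succ]
  simp only [mate_shift, s_shift]
  change c' = c ∧ c = c' ∧ _ ↔ _
  rw [eq_comm (a := c'), ← and_assoc, and_self, Diagram.Fits]

open scoped Kronecker in
theorem colorMatrix_addLeft [DecidableEq C] (P : Diagram m n) :
    colorMatrix C P.addLeft = (1 ⊗ₖ colorMatrix C P : Matrix (C × _) (C × _) ℤ).submatrix
      (Fin.consEquiv fun _ => C).symm (Fin.consEquiv fun _ => C).symm := by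
  ext σ τ
  obtain ⟨⟨c, σ⟩, rfl⟩ := (Fin.consEquiv fun _ => C).surjective σ
  obtain ⟨⟨c', τ⟩, rfl⟩ := (Fin.consEquiv fun _ => C).surjective τ
  have entry : colorMatrix C P.addLeft (Fin.cons c σ) (Fin.cons c' τ) =
      (1 : Matrix C C ℤ) c c' * colorMatrix C P σ τ := by
    rw [Matrix.one_apply, boole_mul, colorMatrix, colorMatrix, Matrix.of_apply, Matrix.of_apply,
      ← ite_and]
    classical exact if_congr (fits_addLeft_iff P c c' σ τ) rfl rfl
  exact entry

theorem addLeft_comp (x : TL m n) (y : TL n k) :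
    addLeft (comp x y) = comp (addLeft x) (addLeft y) := by
  have : (compₗ (m := m) (n := n) (k := k)).compr₂ addLeftₗ =
      (compₗ.compl₂ addLeftₗ) ∘ₗ addLeftₗ := by
    refine ext_single₂ fun P Q => ?_
    change addLeft (comp (single P) (single Q)) = comp (addLeft (single P)) (addLeft (single Q))
    rw [single_comp_single, addLeft_smul, addLeft_single, addLeft_single, addLeft_single,
      single_comp_single_eq_of_colorMatrix Bool]
    rw [colorMatrix_addLeft, colorMatrix_addLeft, Matrix.submatrix_mul_equiv,
      ← Matrix.mul_kronecker_mul, Matrix.one_mul, colorMatrix_mul, Matrix.kronecker_smul,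
      Matrix.submatrix_smul, colorMatrix_addLeft]
    rfl
  exact LinearMap.congr_fun (LinearMap.congr_fun this x) y

/-! ### The identity -/

/-- The identity diagram: all strands run vertically. -/
def Diagram.id (n : ℕ) : Diagram n n where
  mate := Sum.swap
  mate_mate := Sum.swap_swap
  mate_ne := by rintro (p | p) <;> simp
  noncrossing p q := by
    have := pos_swap p
    have := pos_swap q
    omega

theorem Diagram.reflect_id (n : ℕ) : (Diagram.id n).reflect = Diagram.id n :=
  Diagram.ext (funext fun p => Sum.swap_swap p.swap)

theorem Diagram.eq_id_iff {P : Diagram n n} :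
    P = Diagram.id n ↔ ∀ i j : Fin n, i.val = j.val → P.mate (Sum.inl i) = Sum.inr j := by
  constructor
  · rintro rfl i j hij
    rw [Fin.ext hij]
    rfl
  · intro h
    ext1
    funext p
    rcases p with i | i
    · exact h i i rfl
    · rw [← h i i rfl, P.mate_mate, h i i rfl]
      rfl

theorem wire_eq (n : ℕ) : wire n n = single (Diagram.id n) := by
  classical
  funext P
  simp only [wire, single, Pi.single_apply, Diagram.eq_id_iff]

theorem fits_id_iff {σ τ : Fin n → C} : (Diagram.id n).Fits (Sum.elim σ τ) ↔ σ = τ := by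
  constructor
  · exact fun h => funext fun i => h (Sum.inr i)
  · rintro rfl (i | i) <;> rfl

theorem colorMatrix_id [DecidableEq C] (n : ℕ) : colorMatrix C (Diagram.id n) = 1 := by
  ext σ τ
  rw [Matrix.one_apply]
  classical exact if_congr fits_id_iff rfl rfl

theorem wire_comp (x : TL m n) : comp (wire m m) x = x := by
  have : compₗ (wire m m) = (LinearMap.id : TL m n →ₗ[K] TL m n) := by
    refine ext_single fun P => ?_
    rw [wire_eq, compₗ_apply, LinearMap.id_apply,
      single_comp_single_eq_of_colorMatrix Bool (a := 0) (R := P), pow_zero, one_smul]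
    rw [colorMatrix_id, Matrix.one_mul, pow_zero, one_smul]
  exact LinearMap.congr_fun this x

theorem comp_wire (x : TL m n) : comp x (wire n n) = x := by
  have : compₗ.flip (wire n n) = (LinearMap.id : TL m n →ₗ[K] TL m n) := by
    refine ext_single fun P => ?_
    rw [wire_eq, LinearMap.flip_apply, compₗ_apply, LinearMap.id_apply,
      single_comp_single_eq_of_colorMatrix Bool (a := 0) (R := P), pow_zero, one_smul]
    rw [colorMatrix_id, Matrix.mul_one, pow_zero, one_smul]
  exact LinearMap.congr_fun this x

/-! ### The generators -/

section CapMatrix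

variable {ι T : Type*} [DecidableEq ι] {a b c : ι}

/-- The coloring that gives the color `x` to `a` and `b` and agrees with `σ` elsewhere. -/
def recolor (a b : ι) (σ : ι → C) (x : C) : ι → C := fun j => if j = a ∨ j = b then x else σ j

theorem recolor_left (a b : ι) (σ : ι → C) (x : C) : recolor a b σ x a = x :=
  if_pos (Or.inl rfl)

theorem recolor_right (a b : ι) (σ : ι → C) (x : C) : recolor a b σ x b = x :=
  if_pos (Or.inr rfl)

theorem recolor_of_ne {j : ι} (ha : j ≠ a) (hb : j ≠ b) (σ : ι → C) (x : C) :
    recolor a b σ x j = σ j :=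
  if_neg (not_or.2 ⟨ha, hb⟩)

theorem eq_recolor_iff {σ τ : ι → C} {x : C} :
    τ = recolor a b σ x ↔ τ a = x ∧ τ b = x ∧ ∀ j, j ≠ a → j ≠ b → σ j = τ j := by
  constructor
  · rintro rfl
    exact ⟨recolor_left .., recolor_right .., fun j ha hb => (recolor_of_ne ha hb σ x).symm⟩
  · rintro ⟨ha, hb, h⟩
    funext j
    by_cases hj : j = a ∨ j = b
    · rw [recolor, if_pos hj]
      rcases hj with rfl | rfl <;> assumption
    · rw [recolor, if_neg hj]
      exact (h j (fun h => hj (Or.inl h)) fun h => hj (Or.inr h)).symm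

theorem recolor_recolor_of_eq {σ : ι → C} {x : C} (ha : σ a = x) (hb : σ b = x) (y : C) :
    recolor a b (recolor a b σ y) x = σ :=
  (eq_recolor_iff.2 ⟨ha, hb, fun _ ja jb => recolor_of_ne ja jb σ y⟩).symm

theorem recolor_recolor_comm {a' b' : ι} (haa : a ≠ a') (hab : a ≠ b') (hba : b ≠ a')
    (hbb : b ≠ b') (σ : ι → C) (x y : C) :
    recolor a' b' (recolor a b σ x) y = recolor a b (recolor a' b' σ y) x := by
  funext j
  simp only [recolor]
  split_ifs <;> grind

variable [Fintype ι] [DecidableEq C]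

/-- The color matrix of a cup and a cap that join the strands `a` and `b`. -/
def capMatrix (C : Type*) [DecidableEq C] (a b : ι) : Matrix (ι → C) (ι → C) ℤ :=
  Matrix.of fun σ τ => if σ a = σ b ∧ τ a = τ b ∧ ∀ j, j ≠ a → j ≠ b → σ j = τ j then 1 else 0

theorem capMatrix_symm (a b : ι) : capMatrix C a b = capMatrix C b a := by
  ext σ τ
  refine if_congr ?_ rfl rfl
  rw [eq_comm, eq_comm (a := τ a)]
  exact and_congr_right' (and_congr_right' (forall_congr' fun j => imp.swap))

theorem capMatrix_recolor {σ : ι → C} (h : σ a = σ b) (τ : ι → C) (x : C) :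
    capMatrix C a b (recolor a b σ x) τ = capMatrix C a b σ τ := by
  refine if_congr ?_ rfl rfl
  simp only [recolor_left, recolor_right, h, true_and]
  exact and_congr_right' (forall₃_congr fun j ha hb => by rw [recolor_of_ne ha hb])

theorem capMatrix_apply_of_ne {σ : ι → C} (h : σ a ≠ σ b) (τ : ι → C) :
    capMatrix C a b σ τ = 0 :=
  if_neg fun h' => h h'.1

variable [Fintype C]

theorem capMatrix_mul_apply (a b : ι) (X : Matrix (ι → C) T ℤ) (σ : ι → C) (τ : T) :
    (capMatrix C a b * X) σ τ = if σ a = σ b then ∑ x, X (recolor a b σ x) τ else 0 := by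
  have entry (μ : ι → C) : capMatrix C a b σ μ * X μ τ =
      if σ a = σ b then if μ = recolor a b σ (μ a) then X μ τ else 0 else 0 := by
    rw [capMatrix, Matrix.of_apply, boole_mul, ← ite_and]
    refine if_congr (and_congr_right' ?_) rfl rfl
    rw [eq_recolor_iff, eq_comm (a := μ a)]
    simp only [true_and]
  rw [Matrix.mul_apply, Finset.sum_congr rfl fun μ _ => entry μ]
  split_ifs
  · rw [← Finset.sum_filter]
    refine Finset.sum_bij' (fun μ _ => μ a) (fun x _ => recolor a b σ x) (by simp) ?_ ?_ ?_ ?_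
    · exact fun x _ => Finset.mem_filter.2 ⟨Finset.mem_univ _, by rw [recolor_left]⟩
    · exact fun μ hμ => (Finset.mem_filter.1 hμ).2.symm
    · exact fun x _ => recolor_left a b σ x
    · exact fun μ hμ => congrArg (X · τ) (Finset.mem_filter.1 hμ).2
  · exact Finset.sum_const_zero

theorem capMatrix_mul_of_recolor (X : Matrix (ι → C) T ℤ)
    (hne : ∀ σ τ, σ a ≠ σ b → X σ τ = 0)
    (hrecolor : ∀ σ τ x, σ a = σ b → X (recolor a b σ x) τ = X σ τ) :
    capMatrix C a b * X = (Fintype.card C : ℤ) • X := by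
  ext σ τ
  rw [capMatrix_mul_apply, Matrix.smul_apply]
  split_ifs with h
  · rw [Finset.sum_congr rfl fun x _ => hrecolor σ τ x h, Finset.sum_const, Finset.card_univ,
      natCast_zsmul]
  · rw [hne σ τ h, smul_zero]

theorem capMatrix_mul_comm {a' b' : ι} (haa : a ≠ a') (hab : a ≠ b') (hba : b ≠ a')
    (hbb : b ≠ b') : capMatrix C a b * capMatrix C a' b' = capMatrix C a' b' * capMatrix C a b := by
  suffices ∀ X : Matrix (ι → C) (ι → C) ℤ,
      capMatrix C a b * (capMatrix C a' b' * X) = capMatrix C a' b' * (capMatrix C a b * X) by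
    simpa only [Matrix.mul_one] using this 1
  intro X
  ext σ τ
  simp only [capMatrix_mul_apply, recolor_of_ne haa hab, recolor_of_ne hba hbb,
    recolor_of_ne haa.symm hba.symm, recolor_of_ne hab.symm hbb.symm]
  by_cases h : σ a = σ b <;> by_cases h' : σ a' = σ b' <;>
    simp only [h, h', if_true, if_false, Finset.sum_const_zero]
  rw [Finset.sum_comm]
  simp only [recolor_recolor_comm haa hab hba hbb]

theorem capMatrix_mul_capMatrix_mul (hab : a ≠ b) (hac : a ≠ c) (hbc : b ≠ c) :
    capMatrix C a b * (capMatrix C b c * capMatrix C a b) = capMatrix C a b := by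
  ext σ τ
  simp only [capMatrix_mul_apply, recolor_right, recolor_of_ne hac.symm hbc.symm]
  split_ifs with h
  · rw [Finset.sum_ite_eq' Finset.univ (σ c), if_pos (Finset.mem_univ _)]
    have recolor_apply (y : C) : recolor b c (recolor a b σ (σ c)) y a = σ c := by
      rw [recolor_of_ne hab hac, recolor_left]
    rw [Finset.sum_eq_single (σ c)]
    · have : recolor b c (recolor a b σ (σ c)) (σ c) = recolor a b σ (σ c) :=
        (eq_recolor_iff.2
          ⟨recolor_right .., recolor_of_ne hac.symm hbc.symm .., fun _ _ _ => rfl⟩).symm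
      rw [this, capMatrix_recolor h]
    · intro y _ hy
      refine capMatrix_apply_of_ne ?_ τ
      rw [recolor_apply, recolor_left]
      exact hy.symm
    · exact fun h => absurd (Finset.mem_univ _) h
  · exact (capMatrix_apply_of_ne h τ).symm

end CapMatrix

/-- The position `i`, as a strand. -/
abbrev lo (i : Fin (n - 1)) : Fin n := ⟨i, by omega⟩

/-- The position `i + 1`, as a strand. -/
abbrev hi (i : Fin (n - 1)) : Fin n := ⟨i + 1, by omega⟩

theorem lo_ne_hi (i : Fin (n - 1)) : lo i ≠ hi i := by
  simp only [ne_eq, Fin.ext_iff]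
  omega

/-- The cup–cap diagram of the generator `e i`. -/
def Diagram.e (i : Fin (n - 1)) : Diagram n n where
  mate := Sum.elim
    (fun j => if j = lo i then Sum.inl (hi i) else if j = hi i then Sum.inl (lo i) else Sum.inr j)
    (fun j => if j = lo i then Sum.inr (hi i) else if j = hi i then Sum.inr (lo i) else Sum.inl j)
  mate_mate := by
    have := lo_ne_hi i
    rintro (p | p) <;> simp only [Sum.elim_inl, Sum.elim_inr] <;> split_ifs with h1 h2 <;>
      simp_all [eq_comm]
  mate_ne := by
    have := lo_ne_hi i
    rintro (p | p) <;> simp only [Sum.elim_inl, Sum.elim_inr] <;> split_ifs with h1 h2 <;>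
      simp_all [eq_comm]
  noncrossing := by
    rintro (p | p) (q | q) <;> simp only [Sum.elim_inl, Sum.elim_inr] <;> split_ifs <;>
      simp_all only [pos, Fin.ext_iff] <;> omega

theorem Diagram.e_mate_inl_lo (i : Fin (n - 1)) :
    (Diagram.e i).mate (Sum.inl (lo i)) = Sum.inl (hi i) :=
  if_pos rfl

theorem Diagram.e_mate_inr_lo (i : Fin (n - 1)) :
    (Diagram.e i).mate (Sum.inr (lo i)) = Sum.inr (hi i) :=
  if_pos rfl

theorem Diagram.e_mate_inl_of_ne {i : Fin (n - 1)} {j : Fin n} (hlo : j ≠ lo i) (hhi : j ≠ hi i) :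
    (Diagram.e i).mate (Sum.inl j) = Sum.inr j :=
  (if_neg hlo).trans (if_neg hhi)

theorem Diagram.e_point_induction {i : Fin (n - 1)} {r : Point n n → Prop}
    (hmate : ∀ p, r p → r ((Diagram.e i).mate p)) (htop : r (Sum.inl (lo i)))
    (hbottom : r (Sum.inr (lo i))) (hwire : ∀ j, j ≠ lo i → j ≠ hi i → r (Sum.inl j)) (p) :
    r p := by
  have hlohi (j : Fin n) : j = lo i ∨ j = hi i ∨ j ≠ lo i ∧ j ≠ hi i := by tauto
  rcases p with j | j <;> rcases hlohi j with rfl | rfl | ⟨hlo, hhi⟩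
  · exact htop
  · exact Diagram.e_mate_inl_lo i ▸ hmate _ htop
  · exact hwire j hlo hhi
  · exact hbottom
  · exact Diagram.e_mate_inr_lo i ▸ hmate _ hbottom
  · exact Diagram.e_mate_inl_of_ne hlo hhi ▸ hmate _ (hwire j hlo hhi)

theorem Diagram.eq_e_iff {i : Fin (n - 1)} {P : Diagram n n} :
    P = Diagram.e i ↔ P.mate (Sum.inl (lo i)) = Sum.inl (hi i) ∧
      P.mate (Sum.inr (lo i)) = Sum.inr (hi i) ∧
      ∀ j : Fin n, j.val ≠ i.val → j.val ≠ i.val + 1 → P.mate (Sum.inl j) = Sum.inr j := by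
  constructor
  · rintro rfl
    exact ⟨e_mate_inl_lo i, e_mate_inr_lo i, fun j hlo hhi =>
      e_mate_inl_of_ne (fun h => hlo (Fin.ext_iff.1 h)) fun h => hhi (Fin.ext_iff.1 h)⟩
  · rintro ⟨htop, hbottom, hwire⟩
    ext1
    refine funext (Diagram.e_point_induction (i := i) (fun p hp => ?_) ?_ ?_ fun j hlo hhi => ?_)
    · rw [← hp, P.mate_mate, hp, mate_mate]
    · rw [htop, e_mate_inl_lo]
    · rw [hbottom, e_mate_inr_lo]
    · rw [e_mate_inl_of_ne hlo hhi]
      exact hwire j (fun h => hlo (Fin.ext h)) fun h => hhi (Fin.ext h)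

theorem e_eq (i : Fin (n - 1)) : e i = single (Diagram.e i) := by
  classical
  funext P
  simp only [e, single, Pi.single_apply, Diagram.eq_e_iff]

theorem fits_e_iff {i : Fin (n - 1)} {σ τ : Fin n → C} :
    (Diagram.e i).Fits (Sum.elim σ τ) ↔
      σ (lo i) = σ (hi i) ∧ τ (lo i) = τ (hi i) ∧ ∀ j, j ≠ lo i → j ≠ hi i → σ j = τ j := by
  constructor
  · intro h
    exact ⟨h.eq_of_mate_eq (Diagram.e_mate_inl_lo i), h.eq_of_mate_eq (Diagram.e_mate_inr_lo i),
      fun j hlo hhi => h.eq_of_mate_eq (Diagram.e_mate_inl_of_ne hlo hhi)⟩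
  · rintro ⟨htop, hbottom, hwire⟩
    refine Diagram.e_point_induction (i := i) (fun p hp => ?_) ?_ ?_ fun j hlo hhi => ?_
    · rw [Diagram.mate_mate, hp]
    · rw [Diagram.e_mate_inl_lo]
      exact htop.symm
    · rw [Diagram.e_mate_inr_lo]
      exact hbottom.symm
    · rw [Diagram.e_mate_inl_of_ne hlo hhi]
      exact (hwire j hlo hhi).symm

theorem colorMatrix_e [DecidableEq C] (i : Fin (n - 1)) :
    colorMatrix C (Diagram.e i) = capMatrix C (lo i) (hi i) := by
  ext σ τ
  rw [colorMatrix, capMatrix, Matrix.of_apply, Matrix.of_apply]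
  simp only [fits_e_iff]
  congr

theorem Diagram.Fits.recolor {P : Diagram n k} {a b : Fin n}
    (hP : P.mate (Sum.inl a) = Sum.inl b) {σ : Fin n → C} {τ : Fin k → C}
    (h : P.Fits (Sum.elim σ τ)) (x : C) : P.Fits (Sum.elim (recolor a b σ x) τ) := by
  convert h.recolor_arc (Sum.inl a) x using 1
  funext p
  rcases p with j | j <;> simp [TemperleyLieb.recolor, hP]

theorem e_comp_single {P : Diagram n k} {i : Fin (n - 1)}
    (hP : P.mate (Sum.inl (lo i)) = Sum.inl (hi i)) :
    comp (e i) (single P) = d • single P := by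
  rw [e_eq, single_comp_single_eq_of_colorMatrix Bool (a := 1) (R := P), pow_one]
  rw [colorMatrix_e, pow_one]
  refine capMatrix_mul_of_recolor _ (fun σ τ hσ => ?_) fun σ τ x hσ => ?_
  · exact colorMatrix_apply_of_not_fits fun h => hσ (h.eq_of_mate_eq hP)
  · classical
    refine if_congr ⟨fun h => ?_, fun h => h.recolor hP x⟩ rfl rfl
    rw [← recolor_recolor_of_eq rfl hσ.symm x]
    exact h.recolor hP _

theorem e_comp_e (i : Fin (n - 1)) : comp (e i) (e i) = d • e i := by
  simpa only [e_eq] using e_comp_single (Diagram.e_mate_inl_lo i)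

theorem e_comm {i j : Fin (n - 1)} (hij : (i : ℕ) + 1 < j) :
    comp (e i) (e j) = comp (e j) (e i) := by
  have h : colorMatrix Bool (Diagram.e i) * colorMatrix Bool (Diagram.e j) =
      colorMatrix Bool (Diagram.e j) * colorMatrix Bool (Diagram.e i) := by
    simp only [colorMatrix_e]
    apply capMatrix_mul_comm <;> simp only [ne_eq, Fin.ext_iff] <;> omega
  rw [colorMatrix_mul (Diagram.e j)] at h
  rw [e_eq, e_eq, single_comp_single_eq_of_colorMatrix Bool h, single_comp_single]

theorem colorMatrix_e_braid [Fintype C] {i j : Fin (n - 1)}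
    (hij : (i : ℕ) + 1 = j ∨ (j : ℕ) + 1 = i) :
    colorMatrix C (Diagram.e i) * (colorMatrix C (Diagram.e j) * colorMatrix C (Diagram.e i)) =
      colorMatrix C (Diagram.e i) := by
  classical
  simp only [colorMatrix_e]
  have hne := lo_ne_hi i
  rcases hij with hij | hij
  · have hlo : lo j = hi i := Fin.ext hij.symm
    rw [hlo]
    apply capMatrix_mul_capMatrix_mul hne <;> simp only [ne_eq, Fin.ext_iff] <;> omega
  · have hhi : hi j = lo i := Fin.ext hij
    rw [hhi, capMatrix_symm (lo i), capMatrix_symm (lo j)]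
    apply capMatrix_mul_capMatrix_mul hne.symm <;> simp only [ne_eq, Fin.ext_iff] <;> omega

theorem e_braid {i j : Fin (n - 1)} (hij : (i : ℕ) + 1 = j ∨ (j : ℕ) + 1 = i) :
    comp (e i) (comp (e j) (e i)) = e i := by
  have h := colorMatrix_e_braid (C := Bool) hij
  rw [colorMatrix_mul, Matrix.mul_smul, colorMatrix_mul, smul_smul, ← pow_add] at h
  obtain ⟨hcircles, hstack⟩ := eq_of_smul_colorMatrix_eq (b := 0) (by rw [h, pow_zero, one_smul])
  rw [e_eq, e_eq, single_comp_single, comp_smul, single_comp_single, smul_smul, ← pow_add,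
    hcircles, hstack, pow_zero, one_smul]

/-! ### The annular form -/

/-- The form as a bilinear map. -/
def formₗ : TL n n →ₗ[K] TL n n →ₗ[K] Polynomial K :=
  LinearMap.mk₂ K form
    (fun x x' y => by
      simp only [form, Pi.add_apply, add_mul, map_add, Finset.sum_add_distrib])
    (fun c x y => by
      simp only [form, Pi.smul_apply, smul_eq_mul, mul_assoc, map_mul, Finset.smul_sum,
        Polynomial.smul_eq_C_mul])
    (fun x y y' => by
      simp only [form, Pi.add_apply, mul_add, add_mul, map_add, Finset.sum_add_distrib])
    (fun c x y => by
      simp only [form, Pi.smul_apply, smul_eq_mul, mul_left_comm _ c, mul_assoc, map_mul,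
        Finset.smul_sum, Polynomial.smul_eq_C_mul])

theorem form_zero (y : TL n n) : form 0 y = 0 := LinearMap.congr_fun (map_zero formₗ) y

theorem form_smul (c : K) (x y : TL n n) : form (c • x) y = c • form x y :=
  LinearMap.congr_fun (formₗ.map_smul c x) y

theorem form_single (P Q : Diagram n n) : form (single P) (single Q) =
    Polynomial.C d ^ trivialCircles P Q * Polynomial.X ^ essentialCircles P Q := by
  classical
  rw [form, Finset.sum_eq_single P, Finset.sum_eq_single Q]
  · simp [single]
  · intro R _ h; simp [single, h]
  · simp
  · intro R _ h; simp [single, h]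
  · simp

theorem Diagram.Fits.prod_weight_eq {P : Diagram m n} {σ : Fin m → C} {τ : Fin n → C}
    (h : P.Fits (Sum.elim σ τ)) (w : C → ℤˣ) : ∏ i, (w (σ i) : ℤ) = ∏ j, (w (τ j) : ℤ) := by
  have prod_eq_one : ∏ p : Point m n, w (Sum.elim σ τ p) = 1 :=
    Finset.prod_involution (fun p _ => P.mate p) (fun p _ => by rw [h p, Int.units_mul_self])
      (fun p _ _ => P.mate_ne p) (fun _ _ => Finset.mem_univ _) (fun p _ => P.mate_mate p)
  rw [Fintype.prod_sum_type, mul_eq_one_iff_eq_inv, Int.units_inv_eq_self] at prod_eq_one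
  exact_mod_cast congrArg Units.val prod_eq_one

section Weights

variable [DecidableEq C]

/-- The diagonal matrix of the product weights of the colorings; it measures how the circles of an
annular closure meet the closing strands. -/
def weightMatrix (n : ℕ) (w : C → ℤˣ) : Matrix (Fin n → C) (Fin n → C) ℤ :=
  Matrix.diagonal fun σ => ∏ i, (w (σ i) : ℤ)

variable [Fintype C]

theorem colorMatrix_mul_weightMatrix (P : Diagram m n) (w : C → ℤˣ) :
    colorMatrix C P * weightMatrix n w = weightMatrix m w * colorMatrix C P := by
  ext σ τ
  rw [weightMatrix, weightMatrix, Matrix.mul_diagonal, Matrix.diagonal_mul]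
  by_cases h : P.Fits (Sum.elim σ τ)
  · rw [h.prod_weight_eq w, mul_comm]
  · rw [colorMatrix_apply_of_not_fits h, zero_mul, mul_zero]

theorem trace_mul_weightMatrix_comm (P : Diagram m n) (Q : Diagram n m) (w : C → ℤˣ) :
    (colorMatrix C P * colorMatrix C Q * weightMatrix m w).trace =
      (colorMatrix C Q * colorMatrix C P * weightMatrix n w).trace := by
  rw [Matrix.mul_assoc, Matrix.trace_mul_comm, Matrix.mul_assoc, ← colorMatrix_mul_weightMatrix,
    ← Matrix.mul_assoc]

end Weights

/-- Colorings of the circles of a closure are colorings of the two diagrams that agree on top and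
on the bottom. -/
def circleColoringEquiv (P Q : Diagram n n) :
    (Circle P Q → C) ≃ {s : (Fin n → C) × (Fin n → C) //
      P.Fits (Sum.elim s.1 s.2) ∧ Q.reflect.Fits (Sum.elim s.2 s.1)} where
  toFun f := ⟨(fun i => f (Quot.mk _ (Sum.inl (Sum.inl i))),
      fun i => f (Quot.mk _ (Sum.inl (Sum.inr i)))), by
    have upper : Sum.elim (fun i => f (Quot.mk _ (Sum.inl (Sum.inl i))))
        (fun i => f (Quot.mk _ (Sum.inl (Sum.inr i)))) =
        fun p : Point n n => f (Quot.mk _ (Sum.inl p)) := by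
      funext p
      rcases p with p | p <;> rfl
    have lower : Sum.elim (fun i => f (Quot.mk _ (Sum.inl (Sum.inr i))))
        (fun i => f (Quot.mk _ (Sum.inl (Sum.inl i)))) =
        fun p : Point n n => f (Quot.mk _ (Sum.inr p)) := by
      funext p
      rcases p with p | p
      · exact congrArg f (Quot.sound (ClosureAdj.middle p))
      · exact congrArg f (Quot.sound (ClosureAdj.closing p))
    simp only [upper, lower]
    exact ⟨fun p => congrArg f (Quot.sound (ClosureAdj.upper p)).symm,
      fun p => congrArg f (Quot.sound (ClosureAdj.lower p)).symm⟩⟩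
  invFun s := Quot.lift (Sum.elim (Sum.elim s.1.1 s.1.2) (Sum.elim s.1.2 s.1.1)) (by
      intro x y h
      induction h with
      | upper p => exact (s.2.1 p).symm
      | lower p => exact (s.2.2 p).symm
      | middle i => rfl
      | closing i => rfl)
  left_inv f := by
    refine funext (Quot.ind ?_)
    rintro ((i | i) | (i | i))
    · rfl
    · rfl
    · exact congrArg f (Quot.sound (ClosureAdj.middle i))
    · exact congrArg f (Quot.sound (ClosureAdj.closing i))
  right_inv _ := rfl

theorem sum_units_pow [Fintype C] (w : C → ℤˣ) (a : ℕ) :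
    ∑ c, (w c : ℤ) ^ a = if Even a then (Fintype.card C : ℤ) else ∑ c, (w c : ℤ) := by
  split_ifs with h
  · have pow_eq_one (c : C) : (w c : ℤ) ^ a = 1 := by
      rcases Int.units_eq_one_or (w c) with hc | hc <;> simp [hc, h.neg_one_pow]
    simp only [pow_eq_one, Finset.sum_const, Finset.card_univ, nsmul_eq_mul, mul_one]
  · have hodd := Nat.not_even_iff_odd.1 h
    refine Finset.sum_congr rfl fun c _ => ?_
    rcases Int.units_eq_one_or (w c) with hc | hc <;> simp [hc, hodd.neg_one_pow]

theorem trace_closure_eq_sum [Fintype C] [DecidableEq C] (P Q : Diagram n n) (w : C → ℤˣ)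
    [Fintype (Circle P Q)] [DecidableEq (Circle P Q)] :
    (colorMatrix C P * colorMatrix C Q.reflect * weightMatrix n w).trace =
      ∑ f : Circle P Q → C, ∏ i, (w (f (Quot.mk _ (Sum.inl (Sum.inl i)))) : ℤ) := by
  classical
  refine Eq.trans ?_ (Equiv.sum_comp (circleColoringEquiv P Q) fun s => ∏ i, (w (s.1.1 i) : ℤ)).symm
  rw [← Finset.sum_subtype (Finset.univ.filter fun s : (Fin n → C) × (Fin n → C) =>
      P.Fits (Sum.elim s.1 s.2) ∧ Q.reflect.Fits (Sum.elim s.2 s.1)) (by simp)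
    (fun s => ∏ i, (w (s.1 i) : ℤ)), Finset.sum_filter, Fintype.sum_prod_type]
  simp only [Matrix.trace, Matrix.diag_apply, weightMatrix, Matrix.mul_diagonal]
  simp only [Matrix.mul_apply, colorMatrix, Matrix.of_apply, Finset.sum_mul, ite_and, ite_mul,
    one_mul, zero_mul]

theorem prod_closing_eq_prod_circles {M : Type*} [CommMonoid M] (P Q : Diagram n n)
    [Fintype (Circle P Q)] (g : Circle P Q → M) :
    ∏ i, g (Quot.mk _ (Sum.inl (Sum.inl i))) = ∏ c, g c ^ closingStrands c := by
  classical
  rw [← Finset.prod_fiberwise Finset.univ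
    (fun i : Fin n => (Quot.mk _ (Sum.inl (Sum.inl i)) : Circle P Q))]
  refine Finset.prod_congr rfl fun c _ => ?_
  rw [closingStrands, Nat.card_eq_fintype_card, Fintype.card_subtype, ← Finset.prod_const]
  exact Finset.prod_congr rfl fun i hi => congrArg g (Finset.mem_filter.1 hi).2

theorem trace_closure [Fintype C] [DecidableEq C] (P Q : Diagram n n) (w : C → ℤˣ) :
    (colorMatrix C P * colorMatrix C Q.reflect * weightMatrix n w).trace =
      (Fintype.card C : ℤ) ^ trivialCircles P Q * (∑ c, (w c : ℤ)) ^ essentialCircles P Q := by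
  classical
  let _ : Fintype (Circle P Q) := Fintype.ofFinite _
  calc (colorMatrix C P * colorMatrix C Q.reflect * weightMatrix n w).trace
      = ∑ f : Circle P Q → C, ∏ c, (w (f c) : ℤ) ^ closingStrands c := by
        rw [trace_closure_eq_sum]
        exact Finset.sum_congr rfl fun f _ =>
          prod_closing_eq_prod_circles P Q fun c => (w (f c) : ℤ)
    _ = ∏ c : Circle P Q, ∑ x, (w x : ℤ) ^ closingStrands c :=
        (Fintype.prod_sum fun (c : Circle P Q) x => (w x : ℤ) ^ closingStrands c).symm
    _ = _ := by
        simp only [sum_units_pow, Finset.prod_ite, Finset.prod_const, trivialCircles,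
          essentialCircles, Nat.card_eq_fintype_card, Fintype.card_subtype, Nat.not_even_iff_odd]

theorem trace_comp (P : Diagram m n) (Q : Diagram n m) (w : Fin 3 → ℤˣ) :
    (colorMatrix (Fin 3) P * colorMatrix (Fin 3) Q * weightMatrix m w).trace =
      3 ^ (stackCircles P Q + trivialCircles (stack P Q) (Diagram.id m)) *
        (∑ c, (w c : ℤ)) ^ essentialCircles (stack P Q) (Diagram.id m) := by
  have closure := trace_closure (stack P Q) (Diagram.id m) w
  rw [Diagram.reflect_id, colorMatrix_id, Matrix.mul_one, Fintype.card_fin] at closure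
  rw [colorMatrix_mul, Matrix.smul_mul, Matrix.trace_smul, closure, Fintype.card_fin, pow_add,
    smul_eq_mul, mul_assoc, Nat.cast_ofNat]

/-- Three colors suffice to separate the two kinds of circles, since the sum of their weights can
be `3`, as for a trivial circle, or `1`. -/
theorem exponents_eq {t s t' s' : ℕ} (h : ∀ w : Fin 3 → ℤˣ,
    (3 : ℤ) ^ t * (∑ c, (w c : ℤ)) ^ s = 3 ^ t' * (∑ c, (w c : ℤ)) ^ s') : t = t' ∧ s = s' := by
  have hall := h fun _ => 1
  have htrivial := h ![1, 1, -1]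
  rw [show ∑ _c : Fin 3, ((1 : ℤˣ) : ℤ) = 3 by decide, ← pow_add, ← pow_add] at hall
  rw [show ∑ c : Fin 3, ((![1, 1, -1] : Fin 3 → ℤˣ) c : ℤ) = 1 by decide, one_pow, one_pow, mul_one,
    mul_one] at htrivial
  have hadd : t + s = t' + s' := Int.pow_right_injective (by norm_num) hall
  have ht : t = t' := Int.pow_right_injective (by norm_num) htrivial
  omega

theorem form_comp_single (P : Diagram m n) (Q : Diagram n m) :
    form (comp (single P) (single Q)) (wire m m) =
      Polynomial.C d ^ (stackCircles P Q + trivialCircles (stack P Q) (Diagram.id m)) *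
        Polynomial.X ^ essentialCircles (stack P Q) (Diagram.id m) := by
  rw [single_comp_single, wire_eq, form_smul, form_single, Polynomial.smul_eq_C_mul, map_pow,
    pow_add, mul_assoc]

theorem form_comp_comm (x : TL m n) (y : TL n m) :
    form (comp x y) (wire m m) = form (comp y x) (wire n n) := by
  have : (compₗ (m := m) (n := n) (k := m)).compr₂ (formₗ.flip (wire m m)) =
      ((compₗ (m := n) (n := m) (k := n)).compr₂ (formₗ.flip (wire n n))).flip := by
    refine ext_single₂ fun P Q => ?_
    change form (comp (single P) (single Q)) _ = form (comp (single Q) (single P)) _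
    obtain ⟨htrivial, hessential⟩ := exponents_eq fun w => (trace_comp P Q w).symm.trans
      ((trace_mul_weightMatrix_comm P Q w).trans (trace_comp Q P w))
    rw [form_comp_single, form_comp_single, htrivial, hessential]
  exact LinearMap.congr_fun (LinearMap.congr_fun this x) y

theorem form_eq_form_comp_reflect (x y : TL n n) :
    form x y = form (comp x (reflect y)) (wire n n) := by
  have : formₗ = ((compₗ (m := n) (n := n) (k := n)).compr₂ (formₗ.flip (wire n n))).compl₂
      reflectₗ := by
    refine ext_single₂ fun P Q => ?_
    change form (single P) (single Q) = form (comp (single P) (reflect (single Q))) _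
    obtain ⟨htrivial, hessential⟩ := exponents_eq fun w => (trace_closure P Q w).symm.trans
      (trace_comp P Q.reflect w)
    rw [reflect_single, form_comp_single, form_single, htrivial, hessential]
  exact LinearMap.congr_fun (LinearMap.congr_fun this x) y

/-! ### Reduced words of permutations -/

theorem lo_lt_hi (i : Fin (n - 1)) : lo i < hi i := Nat.lt_succ_self _

theorem adjSwap_lo (i : Fin (n - 1)) : adjSwap i (lo i) = hi i := Equiv.swap_apply_left _ _

theorem adjSwap_hi (i : Fin (n - 1)) : adjSwap i (hi i) = lo i := Equiv.swap_apply_right _ _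

theorem adjSwap_of_ne {i : Fin (n - 1)} {j : Fin n} (hlo : j ≠ lo i) (hhi : j ≠ hi i) :
    adjSwap i j = j := Equiv.swap_apply_of_ne_of_ne hlo hhi

theorem adjSwap_adjSwap (i : Fin (n - 1)) (j : Fin n) : adjSwap i (adjSwap i j) = j :=
  Equiv.swap_apply_self _ _ _

theorem adjSwap_mul_adjSwap_mul (i : Fin (n - 1)) (π : Equiv.Perm (Fin n)) :
    adjSwap i * (adjSwap i * π) = π := Equiv.swap_mul_self_mul _ _ _

theorem inv_adjSwap_mul_apply (i : Fin (n - 1)) (π : Equiv.Perm (Fin n)) (j : Fin n) :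
    (adjSwap i * π)⁻¹ j = π⁻¹ (adjSwap i j) := by
  rw [mul_inv_rev, Equiv.Perm.mul_apply, adjSwap, Equiv.swap_inv]

theorem adjSwap_lt_adjSwap_iff {i : Fin (n - 1)} {j k : Fin n} (h : ¬(j = lo i ∧ k = hi i))
    (h' : ¬(j = hi i ∧ k = lo i)) : adjSwap i j < adjSwap i k ↔ j < k := by
  by_cases jlo : j = lo i <;> by_cases jhi : j = hi i <;> by_cases klo : k = lo i <;>
    by_cases khi : k = hi i <;>
    simp_all only [adjSwap_of_ne, adjSwap_lo, adjSwap_hi, ne_eq, not_false_eq_true, and_self,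
      not_true_eq_false, and_false, false_and, lt_self_iff_false] <;>
    simp only [lo, hi, Fin.ext_iff, Fin.lt_def] at * <;> omega

/-- The inversions of a permutation, given by the pairs of its values. -/
def inversions (π : Equiv.Perm (Fin n)) : Finset (Fin n × Fin n) :=
  {p | p.1 < p.2 ∧ π⁻¹ p.2 < π⁻¹ p.1}

theorem mem_inversions {π : Equiv.Perm (Fin n)} {j k : Fin n} :
    (j, k) ∈ inversions π ↔ j < k ∧ π⁻¹ k < π⁻¹ j := by
  simp only [inversions, Finset.mem_filter, Finset.mem_univ, true_and]

theorem inversions_one : inversions (1 : Equiv.Perm (Fin n)) = ∅ :=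
  Finset.filter_eq_empty_iff.2 fun _ _ h => h.1.asymm h.2

theorem inversions_adjSwap_mul {π : Equiv.Perm (Fin n)} {i : Fin (n - 1)}
    (h : π⁻¹ (lo i) < π⁻¹ (hi i)) : inversions (adjSwap i * π) = insert (lo i, hi i)
      ((inversions π).map ((adjSwap i).prodCongr (adjSwap i)).toEmbedding) := by
  ext ⟨j, k⟩
  have symm_apply : ((adjSwap i).prodCongr (adjSwap i)).symm (j, k) =
      (adjSwap i j, adjSwap i k) := by
    simp only [Equiv.symm_apply_eq, Equiv.prodCongr_apply, Prod.map, adjSwap_adjSwap]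
  rw [Finset.mem_insert, Finset.mem_map_equiv, symm_apply, mem_inversions, mem_inversions,
    Prod.mk.injEq, inv_adjSwap_mul_apply, inv_adjSwap_mul_apply]
  by_cases hlohi : j = lo i ∧ k = hi i
  · obtain ⟨rfl, rfl⟩ := hlohi
    simp only [adjSwap_lo, adjSwap_hi, lo_lt_hi, h, and_self, true_or]
  by_cases hhilo : j = hi i ∧ k = lo i
  · obtain ⟨rfl, rfl⟩ := hhilo
    simp only [adjSwap_lo, adjSwap_hi, (lo_lt_hi i).not_gt, h.not_gt, (lo_ne_hi i).symm,
      false_and, and_false, or_false]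
  · rw [adjSwap_lt_adjSwap_iff hlohi hhilo, or_iff_right hlohi]

/-- The length of a permutation, as its number of inversions. -/
def len (π : Equiv.Perm (Fin n)) : ℕ := (inversions π).card

theorem len_adjSwap_mul {π : Equiv.Perm (Fin n)} {i : Fin (n - 1)}
    (h : π⁻¹ (lo i) < π⁻¹ (hi i)) : len (adjSwap i * π) = len π + 1 := by
  rw [len, inversions_adjSwap_mul h, Finset.card_insert_of_notMem, Finset.card_map, len]
  rw [Finset.mem_map_equiv]
  have symm_apply : ((adjSwap i).prodCongr (adjSwap i)).symm (lo i, hi i) = (hi i, lo i) := by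
    simp only [Equiv.symm_apply_eq, Equiv.prodCongr_apply, Prod.map, adjSwap_lo, adjSwap_hi]
  rw [symm_apply, mem_inversions]
  exact fun hmem => (lo_lt_hi i).asymm hmem.1

theorem len_adjSwap_mul_add_one {π : Equiv.Perm (Fin n)} {i : Fin (n - 1)}
    (h : π⁻¹ (hi i) < π⁻¹ (lo i)) : len (adjSwap i * π) + 1 = len π := by
  rw [← len_adjSwap_mul (i := i), adjSwap_mul_adjSwap_mul]
  rwa [inv_adjSwap_mul_apply, inv_adjSwap_mul_apply, adjSwap_lo, adjSwap_hi]

theorem lt_or_gt_inv_apply (π : Equiv.Perm (Fin n)) (i : Fin (n - 1)) :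
    π⁻¹ (lo i) < π⁻¹ (hi i) ∨ π⁻¹ (hi i) < π⁻¹ (lo i) :=
  lt_or_gt_of_ne (π⁻¹.injective.ne (lo_ne_hi i))

theorem wordPerm_cons (i : Fin (n - 1)) (w : List (Fin (n - 1))) :
    wordPerm (i :: w) = adjSwap i * wordPerm w := by
  simp only [wordPerm, List.map_cons, List.prod_cons]

theorem len_wordPerm_le (w : List (Fin (n - 1))) : len (wordPerm w) ≤ w.length := by
  induction w with
  | nil => exact (congrArg Finset.card inversions_one).le
  | cons i w ih =>
    rw [wordPerm_cons, List.length_cons]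
    rcases lt_or_gt_inv_apply (wordPerm w) i with h | h
    · rw [len_adjSwap_mul h]
      omega
    · have := len_adjSwap_mul_add_one h
      omega

/-- A word is reduced if it is as short as its permutation permits. -/
def Reduced (w : List (Fin (n - 1))) : Prop := w.length = len (wordPerm w)

theorem reduced_nil : Reduced ([] : List (Fin (n - 1))) :=
  (congrArg Finset.card inversions_one).symm

theorem reduced_cons_iff {i : Fin (n - 1)} {w : List (Fin (n - 1))} :
    Reduced (i :: w) ↔ Reduced w ∧ (wordPerm w)⁻¹ (lo i) < (wordPerm w)⁻¹ (hi i) := by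
  rw [Reduced, Reduced, wordPerm_cons, List.length_cons]
  rcases lt_or_gt_inv_apply (wordPerm w) i with h | h
  · rw [len_adjSwap_mul h, add_left_inj, and_iff_left h]
  · have hlen := len_adjSwap_mul_add_one h
    have hle := len_wordPerm_le w
    exact ⟨fun hred => by omega, fun hred => absurd hred.2 h.asymm⟩

theorem Reduced.inv_apply_lt {i : Fin (n - 1)} {w : List (Fin (n - 1))} (h : Reduced (i :: w)) :
    (wordPerm (i :: w))⁻¹ (hi i) < (wordPerm (i :: w))⁻¹ (lo i) := by
  rw [wordPerm_cons, inv_adjSwap_mul_apply, inv_adjSwap_mul_apply, adjSwap_lo, adjSwap_hi]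
  exact (reduced_cons_iff.1 h).2

theorem exists_inv_apply_lt {π : Equiv.Perm (Fin n)} (h : π ≠ 1) :
    ∃ i : Fin (n - 1), π⁻¹ (hi i) < π⁻¹ (lo i) := by
  contrapose! h
  have mono : StrictMono ⇑π⁻¹ := by
    rcases n with _ | n
    · exact fun j => j.elim0
    · exact Fin.strictMono_iff_lt_succ.2 fun i =>
        (h i).lt_of_ne (π⁻¹.injective.ne (lo_ne_hi (n := n + 1) i))
  have inv_eq_refl : mono.orderIsoOfSurjective _ π⁻¹.surjective = OrderIso.refl (Fin n) :=
    Subsingleton.elim _ _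
  exact inv_eq_one.1 (Equiv.ext fun j => DFunLike.congr_fun inv_eq_refl j)

theorem exists_reduced (π : Equiv.Perm (Fin n)) : ∃ w, Reduced w ∧ wordPerm w = π := by
  induction hN : len π generalizing π with
  | zero =>
    refine ⟨[], reduced_nil, Eq.symm ?_⟩
    by_contra h
    obtain ⟨i, hlt⟩ := exists_inv_apply_lt h
    have := len_adjSwap_mul_add_one hlt
    omega
  | succ N ih =>
    have hπ : π ≠ 1 := by
      rintro rfl
      rw [len, inversions_one, Finset.card_empty] at hN
      omega
    obtain ⟨i, hlt⟩ := exists_inv_apply_lt hπ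
    obtain ⟨w, hw, hwπ⟩ := ih (adjSwap i * π) (by have := len_adjSwap_mul_add_one hlt; omega)
    refine ⟨i :: w, reduced_cons_iff.2 ⟨hw, ?_⟩, by
      rw [wordPerm_cons, hwπ, adjSwap_mul_adjSwap_mul]⟩
    rwa [hwπ, inv_adjSwap_mul_apply, inv_adjSwap_mul_apply, adjSwap_lo, adjSwap_hi]

theorem wordPerm_minWord (π : Equiv.Perm (Fin n)) : wordPerm (minWord π) = π :=
  Function.argminOn_mem List.length _ (exists_word π)

theorem reduced_minWord (π : Equiv.Perm (Fin n)) : Reduced (minWord π) := by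
  obtain ⟨w, hw, hwπ⟩ := exists_reduced π
  refine le_antisymm ?_ (len_wordPerm_le _)
  rw [wordPerm_minWord, ← hwπ, ← hw, hwπ]
  exact Function.argminOn_le List.length _ hwπ

/-! ### Matsumoto's theorem for the symmetric group -/

theorem adjSwap_comm {i j : Fin (n - 1)} (hij : (i : ℕ) + 1 < j) :
    adjSwap i * adjSwap j = adjSwap j * adjSwap i := by
  refine (Equiv.Perm.Disjoint.commute fun k => ?_ :)
  by_cases hk : k = lo j ∨ k = hi j
  · left
    apply adjSwap_of_ne <;> rcases hk with rfl | rfl <;>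
      simp only [lo, hi, ne_eq, Fin.ext_iff] <;> omega
  · exact .inr (adjSwap_of_ne (not_or.1 hk).1 (not_or.1 hk).2)

theorem adjSwap_braid {i j : Fin (n - 1)} (hij : (i : ℕ) + 1 = j) :
    adjSwap i * (adjSwap j * adjSwap i) = adjSwap j * (adjSwap i * adjSwap j) := by
  have lo_j : lo j = hi i := Fin.ext hij.symm
  have swap_i : adjSwap i = Equiv.swap (lo i) (hi i) := rfl
  have swap_j : adjSwap j = Equiv.swap (hi i) (hi j) := by rw [← lo_j]; rfl
  have hij' : hi i ≠ hi j := lo_j ▸ lo_ne_hi j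
  have hlohi : lo i ≠ hi j := ((lo_lt_hi i).trans (lo_j ▸ lo_lt_hi j)).ne
  rw [← mul_assoc, ← mul_assoc, swap_i, swap_j, Equiv.swap_comm (lo i) (hi i),
    Equiv.swap_comm (hi i) (hi j), Equiv.swap_mul_swap_mul_swap hij'.symm hlohi.symm,
    Equiv.swap_comm (hi j) (hi i), Equiv.swap_comm (hi i) (lo i),
    Equiv.swap_mul_swap_mul_swap (lo_ne_hi i) hlohi, Equiv.swap_comm]

theorem exists_reduced_of_far {i j : Fin (n - 1)} (hij : (i : ℕ) + 1 < j)
    {π : Equiv.Perm (Fin n)} (hπi : π⁻¹ (hi i) < π⁻¹ (lo i)) (hπj : π⁻¹ (hi j) < π⁻¹ (lo j)) :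
    ∃ x, Reduced (i :: j :: x) ∧ Reduced (j :: i :: x) ∧ wordPerm (i :: j :: x) = π ∧
      wordPerm (j :: i :: x) = π := by
  obtain ⟨x, hx, hxπ⟩ := exists_reduced (adjSwap j * (adjSwap i * π))
  have i_lo : adjSwap i (lo j) = lo j := by
    apply adjSwap_of_ne <;> simp only [lo, hi, ne_eq, Fin.ext_iff] <;> omega
  have i_hi : adjSwap i (hi j) = hi j := by
    apply adjSwap_of_ne <;> simp only [lo, hi, ne_eq, Fin.ext_iff] <;> omega
  have j_lo : adjSwap j (lo i) = lo i := by
    apply adjSwap_of_ne <;> simp only [lo, hi, ne_eq, Fin.ext_iff] <;> omega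
  have j_hi : adjSwap j (hi i) = hi i := by
    apply adjSwap_of_ne <;> simp only [lo, hi, ne_eq, Fin.ext_iff] <;> omega
  have hij_word : wordPerm (i :: j :: x) = π := by
    simp only [wordPerm_cons, hxπ, adjSwap_mul_adjSwap_mul]
  refine ⟨x, ?_, ?_, hij_word, ?_⟩
  · simp only [reduced_cons_iff, hx, wordPerm_cons, hxπ, adjSwap_mul_adjSwap_mul,
      inv_adjSwap_mul_apply, i_lo, i_hi, adjSwap_lo, adjSwap_hi, hπi, hπj, true_and]
  · simp only [reduced_cons_iff, hx, wordPerm_cons, hxπ, inv_adjSwap_mul_apply, i_lo, i_hi, j_lo,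
      j_hi, adjSwap_lo, adjSwap_hi, hπi, hπj, true_and]
  · rw [← hij_word, wordPerm_cons, wordPerm_cons, wordPerm_cons, wordPerm_cons, ← mul_assoc,
      ← adjSwap_comm hij, mul_assoc]

theorem exists_reduced_of_adjacent {i j : Fin (n - 1)} (hij : (i : ℕ) + 1 = j)
    {π : Equiv.Perm (Fin n)} (hπi : π⁻¹ (hi i) < π⁻¹ (lo i)) (hπj : π⁻¹ (hi j) < π⁻¹ (lo j)) :
    ∃ x, Reduced (i :: j :: i :: x) ∧ Reduced (j :: i :: j :: x) ∧
      wordPerm (i :: j :: i :: x) = π ∧ wordPerm (j :: i :: j :: x) = π := by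
  obtain ⟨x, hx, hxπ⟩ := exists_reduced (adjSwap i * (adjSwap j * (adjSwap i * π)))
  have lo_j : lo j = hi i := Fin.ext hij.symm
  have hlt := lo_j ▸ lo_lt_hi j
  rw [lo_j] at hπj
  have i_hi_j : adjSwap i (hi j) = hi j :=
    adjSwap_of_ne ((lo_lt_hi i).trans hlt).ne' hlt.ne'
  have j_lo_i : adjSwap j (lo i) = lo i :=
    adjSwap_of_ne (lo_j ▸ lo_ne_hi i) ((lo_lt_hi i).trans hlt).ne
  have j_hi_i : adjSwap j (hi i) = hi j := lo_j ▸ adjSwap_lo j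
  have j_hi_j : adjSwap j (hi j) = hi i := lo_j ▸ adjSwap_hi j
  have hij_word : wordPerm (i :: j :: i :: x) = π := by
    simp only [wordPerm_cons, hxπ, adjSwap_mul_adjSwap_mul]
  refine ⟨x, ?_, ?_, hij_word, ?_⟩
  · simp only [reduced_cons_iff, hx, wordPerm_cons, hxπ, adjSwap_mul_adjSwap_mul,
      inv_adjSwap_mul_apply, lo_j, i_hi_j, j_lo_i, j_hi_i, adjSwap_lo, adjSwap_hi, hπi, hπj,
      hπj.trans hπi, true_and]
  · simp only [reduced_cons_iff, hx, wordPerm_cons, hxπ, inv_adjSwap_mul_apply, lo_j, i_hi_j,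
      j_lo_i, j_hi_i, j_hi_j, adjSwap_lo, adjSwap_hi, hπi, hπj, hπj.trans hπi, true_and]
  · rw [← hij_word]
    simp only [wordPerm_cons, ← mul_assoc]
    rw [mul_assoc (adjSwap j), ← adjSwap_braid hij, ← mul_assoc]

theorem Reduced.prod_eq {M : Type*} [Monoid M] {s : Fin (n - 1) → M}
    (hcomm : ∀ i j : Fin (n - 1), (i : ℕ) + 1 < j → s i * s j = s j * s i)
    (hbraid : ∀ i j : Fin (n - 1), (i : ℕ) + 1 = j → s i * (s j * s i) = s j * (s i * s j))
    {u v : List (Fin (n - 1))} (hu : Reduced u) (hv : Reduced v) (huv : wordPerm u = wordPerm v) :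
    (u.map s).prod = (v.map s).prod := by
  induction hN : u.length generalizing u v with
  | zero =>
    rw [hu, huv, ← hv, List.length_eq_zero_iff] at hN
    rw [List.length_eq_zero_iff.1 (hu.trans (by rw [huv, ← hv, hN, List.length_nil])), hN]
  | succ N ih =>
    have cons_eq {i : Fin (n - 1)} {u v : List (Fin (n - 1))} (hu : Reduced (i :: u))
        (hv : Reduced (i :: v)) (huv : wordPerm (i :: u) = wordPerm (i :: v))
        (hN : (i :: u).length = N + 1) : ((i :: u).map s).prod = ((i :: v).map s).prod := by
      rw [wordPerm_cons, wordPerm_cons] at huv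
      rw [List.map_cons, List.map_cons, List.prod_cons, List.prod_cons,
        ih (reduced_cons_iff.1 hu).1 (reduced_cons_iff.1 hv).1 (mul_left_cancel huv)
          (Nat.succ_injective hN)]
    have hN' : v.length = N + 1 := by rw [← hN, hu, hv, huv]
    obtain ⟨i, u, rfl⟩ := List.exists_cons_of_length_eq_add_one hN
    obtain ⟨j, v, rfl⟩ := List.exists_cons_of_length_eq_add_one hN'
    wlog hij : i ≤ j generalizing i j u v
    · exact (this j v hv hN' i u hu hN huv.symm (le_of_not_ge hij)).symm
    rcases hij.eq_or_lt with rfl | hij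
    · exact cons_eq hu hv huv hN
    have hπj := huv ▸ hv.inv_apply_lt
    rcases (Nat.succ_le_of_lt hij).eq_or_lt with adjacent | far
    · obtain ⟨x, hix, hjx, hixπ, hjxπ⟩ := exists_reduced_of_adjacent adjacent hu.inv_apply_lt hπj
      rw [cons_eq hu hix hixπ.symm hN, cons_eq hv hjx (huv.symm.trans hjxπ.symm) hN']
      simpa only [List.map_cons, List.prod_cons, mul_assoc] using
        congrArg (· * (x.map s).prod) (hbraid i j adjacent)
    · obtain ⟨x, hix, hjx, hixπ, hjxπ⟩ := exists_reduced_of_far far hu.inv_apply_lt hπj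
      rw [cons_eq hu hix hixπ.symm hN, cons_eq hv hjx (huv.symm.trans hjxπ.symm) hN']
      simp only [List.map_cons, List.prod_cons, ← mul_assoc, hcomm i j far]

/-! ### Jones–Wenzl idempotents absorb no cups -/

theorem A_ne_zero : A ≠ 0 := RatFunc.X_ne_zero

theorem d_ne_zero : d ≠ 0 := by
  intro hd
  have eq_neg_sq_mul_d : A ^ 4 + 1 = -(A ^ 2 * d) := by
    have := A_ne_zero
    rw [d]
    field_simp
    ring
  have hpoly : algebraMap (Polynomial ℚ) K (Polynomial.X ^ 4 + 1) = 0 := by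
    rw [map_add, map_pow, map_one, RatFunc.algebraMap_X]
    exact eq_neg_sq_mul_d.trans (by rw [hd, mul_zero, neg_zero])
  rw [map_eq_zero_iff _ (RatFunc.algebraMap_injective ℚ)] at hpoly
  simpa using congrArg (Polynomial.eval 0) hpoly

theorem braid_expand {F R : Type*} [Field F] [Ring R] [Algebra F R] {a : F} (ha : a ≠ 0) {x y : R}
    (hx : x * x = (-(a⁻¹) ^ 2 - a ^ 2) • x) (hxyx : x * (y * x) = x) :
    (a • 1 + a⁻¹ • x) * ((a • 1 + a⁻¹ • y) * (a • 1 + a⁻¹ • x)) =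
      a ^ 3 • 1 + a • (x + y) + a⁻¹ • (x * y + y * x) := by
  simp only [add_mul, mul_add, smul_mul_assoc, mul_smul_comm, one_mul, mul_one, hx, hxyx, smul_add,
    smul_smul]
  match_scalars <;> field_simp
  ring

theorem mul_smul_one_add_smul {F R : Type*} [Field F] [Ring R] [Algebra F R] {a : F} (ha : a ≠ 0)
    {x : R} (hx : x * x = (-(a⁻¹) ^ 2 - a ^ 2) • x) :
    x * (a • 1 + a⁻¹ • x) = -(a⁻¹) ^ 3 • x := by
  rw [mul_add, mul_smul_comm, mul_smul_comm, mul_one, hx]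
  match_scalars
  field_simp
  ring

/-- Left multiplication as an endomorphism. It embeds `TL n n`, which carries no ring structure,
into a ring, where computations in the Temperley–Lieb algebra take place. -/
def mulLeft (x : TL n n) : Module.End K (TL n n) := compₗ x

theorem mulLeft_comp (x y : TL n n) : mulLeft (comp x y) = mulLeft x * mulLeft y :=
  LinearMap.ext fun z => comp_assoc x y z

theorem mulLeft_injective : Function.Injective (mulLeft (n := n)) := fun x y h =>
  (comp_wire x).symm.trans ((LinearMap.congr_fun h (wire n n)).trans (comp_wire y))

theorem mulLeft_wire : mulLeft (wire n n) = 1 := LinearMap.ext wire_comp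

theorem mulLeft_crossing (i : Fin (n - 1)) :
    mulLeft (crossing i) = A • 1 + A⁻¹ • mulLeft (e i) := by
  rw [← mulLeft_wire]
  exact (map_add compₗ _ _).trans (congrArg₂ (· + ·) (map_smul compₗ _ _) (map_smul compₗ _ _))

theorem mulLeft_e_mul_self (i : Fin (n - 1)) :
    mulLeft (e i) * mulLeft (e i) = d • mulLeft (e i) := by
  rw [← mulLeft_comp, e_comp_e]
  exact map_smul compₗ d (e i)

theorem mulLeft_e_mul_e_mul {i j : Fin (n - 1)} (hij : (i : ℕ) + 1 = j ∨ (j : ℕ) + 1 = i) :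
    mulLeft (e i) * (mulLeft (e j) * mulLeft (e i)) = mulLeft (e i) := by
  rw [← mulLeft_comp, ← mulLeft_comp, e_braid hij]

theorem crossing_comm {i j : Fin (n - 1)} (hij : (i : ℕ) + 1 < j) :
    Commute (mulLeft (crossing i)) (mulLeft (crossing j)) := by
  have he : Commute (mulLeft (e i)) (mulLeft (e j)) := by
    rw [Commute, SemiconjBy, ← mulLeft_comp, e_comm hij, mulLeft_comp]
  rw [mulLeft_crossing, mulLeft_crossing]
  exact ((Commute.one_left _).smul_left A).add_left
    ((((Commute.one_right _).smul_right A).add_right (he.smul_right A⁻¹)).smul_left A⁻¹)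

theorem crossing_braid {i j : Fin (n - 1)} (hij : (i : ℕ) + 1 = j) :
    mulLeft (crossing i) * (mulLeft (crossing j) * mulLeft (crossing i)) =
      mulLeft (crossing j) * (mulLeft (crossing i) * mulLeft (crossing j)) := by
  simp only [mulLeft_crossing]
  rw [braid_expand A_ne_zero (mulLeft_e_mul_self i) (mulLeft_e_mul_e_mul (.inl hij)),
    braid_expand A_ne_zero (mulLeft_e_mul_self j) (mulLeft_e_mul_e_mul (.inr hij)),
    add_comm (mulLeft (e i)) (mulLeft (e j)), add_comm (mulLeft (e i) * mulLeft (e j))]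

theorem mulLeft_braidWord (w : List (Fin (n - 1))) :
    mulLeft (braidWord w) = (w.map fun i => mulLeft (crossing i)).prod := by
  induction w with
  | nil => exact mulLeft_wire
  | cons i w ih =>
    rw [List.map_cons, List.prod_cons, ← ih, ← mulLeft_comp]
    rfl

theorem braidWord_eq_of_reduced {u v : List (Fin (n - 1))} (hu : Reduced u) (hv : Reduced v)
    (huv : wordPerm u = wordPerm v) : braidWord u = braidWord v := by
  apply mulLeft_injective
  rw [mulLeft_braidWord, mulLeft_braidWord]
  exact hu.prod_eq (fun i j => crossing_comm) (fun i j => crossing_braid) hv huv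

theorem e_comp_crossing_comp (i : Fin (n - 1)) (x : TL n n) :
    comp (e i) (comp (crossing i) x) = -(A⁻¹) ^ 3 • comp (e i) x := by
  have h : mulLeft (e i) * mulLeft (crossing i) = -(A⁻¹) ^ 3 • mulLeft (e i) := by
    rw [mulLeft_crossing]
    exact mul_smul_one_add_smul A_ne_zero (mulLeft_e_mul_self i)
  exact LinearMap.congr_fun h x

theorem e_comp_term_add_e_comp_term {i : Fin (n - 1)} {π : Equiv.Perm (Fin n)}
    (h : π⁻¹ (lo i) < π⁻¹ (hi i)) :
    (A ^ 3) ^ (minWord π).length • comp (e i) (braidWord (minWord π)) +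
      (A ^ 3) ^ (minWord (adjSwap i * π)).length •
        comp (e i) (braidWord (minWord (adjSwap i * π))) = 0 := by
  have reduced : Reduced (i :: minWord π) :=
    reduced_cons_iff.2 ⟨reduced_minWord π, by rwa [wordPerm_minWord]⟩
  have same_perm : wordPerm (minWord (adjSwap i * π)) = wordPerm (i :: minWord π) := by
    rw [wordPerm_minWord, wordPerm_cons, wordPerm_minWord]
  have length_eq : (minWord (adjSwap i * π)).length = (minWord π).length + 1 :=
    (reduced_minWord _).trans ((congrArg len same_perm).trans reduced.symm)
  have word_eq : braidWord (minWord (adjSwap i * π)) = comp (crossing i) (braidWord (minWord π)) :=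
    braidWord_eq_of_reduced (reduced_minWord _) reduced same_perm
  have hA : A ^ 3 * -(A⁻¹) ^ 3 = -1 := by
    rw [mul_neg, ← mul_pow, mul_inv_cancel₀ A_ne_zero, one_pow]
  rw [word_eq, e_comp_crossing_comp, length_eq, smul_smul, pow_succ (A ^ 3), mul_assoc, hA,
    mul_neg_one, neg_smul, add_neg_cancel]

theorem e_comp_jonesWenzl (i : Fin (n - 1)) : comp (e i) (jonesWenzl n) = 0 := by
  rw [jonesWenzl, comp_smul, ← compₗ_apply, map_sum]
  simp only [map_smul, compₗ_apply]
  -- The terms of `π` and `adjSwap i * π` cancel.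
  rw [Finset.sum_involution (fun π _ => adjSwap i * π), smul_zero]
  · intro π _
    rcases lt_or_gt_inv_apply π i with h | h
    · exact e_comp_term_add_e_comp_term h
    · have hcancel := e_comp_term_add_e_comp_term (i := i) (π := adjSwap i * π) (by
        rwa [inv_adjSwap_mul_apply, inv_adjSwap_mul_apply, adjSwap_lo, adjSwap_hi])
      rwa [adjSwap_mul_adjSwap_mul, add_comm] at hcancel
  · intro π _ _ h
    have hlo := congrArg (fun ρ => ρ⁻¹ (lo i)) h
    simp only [inv_adjSwap_mul_apply, adjSwap_lo] at hlo
    exact lo_ne_hi i (π⁻¹.injective hlo).symm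
  · exact fun _ _ => Finset.mem_univ _
  · exact fun π _ => adjSwap_mul_adjSwap_mul i π

/-! ### Orthogonality -/

theorem Diagram.pos_mate_mem_Ioo (P : Diagram m n) {p q : Point m n}
    (hq : pos q ∈ Set.Ioo (pos p) (pos (P.mate p))) :
    pos (P.mate q) ∈ Set.Ioo (pos p) (pos (P.mate p)) := by
  have hnot_above := P.noncrossing p q
  have hnot_below := P.noncrossing (P.mate q) p
  have hne_left : pos (P.mate q) ≠ pos p := fun h =>
    hq.2.ne (by rw [← pos_injective h, P.mate_mate])
  have hne_right : pos (P.mate q) ≠ pos (P.mate p) := fun h =>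
    hq.1.ne' (by rw [← P.mate_mate q, pos_injective h, P.mate_mate])
  rw [P.mate_mate] at hnot_below
  simp only [Set.mem_Ioo] at hq ⊢
  omega

theorem Diagram.exists_cup_of_lt (P : Diagram m n) (h : n < m) :
    ∃ p q : Fin m, p < q ∧ P.mate (Sum.inl p) = Sum.inl q := by
  by_contra! hcup
  have through (p : Fin m) : ∃ j : Fin n, P.mate (Sum.inl p) = Sum.inr j := by
    rcases hp : P.mate (Sum.inl p) with q | j
    · rcases lt_trichotomy p q with hpq | rfl | hpq
      · exact absurd hp (hcup p q hpq)
      · exact absurd hp (P.mate_ne _)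
      · exact absurd (by rw [← hp, P.mate_mate]) (hcup q p hpq)
    · exact ⟨j, rfl⟩
  choose f hf using through
  have hinj : Function.Injective f := fun p q hpq => Sum.inl_injective <| by
    rw [← P.mate_mate (Sum.inl p), hf, hpq, ← hf, P.mate_mate]
  exact h.not_ge (by simpa only [Fintype.card_fin] using Fintype.card_le_of_injective f hinj)

theorem Diagram.exists_adjacent_cup (P : Diagram m n) {p q : Fin m} (hpq : p < q)
    (hp : P.mate (Sum.inl p) = Sum.inl q) :
    ∃ i : Fin (m - 1), P.mate (Sum.inl (lo i)) = Sum.inl (hi i) := by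
  induction hg : (q : ℕ) - p using Nat.strong_induction_on generalizing p q with
  | _ g ih =>
  have := q.isLt
  rcases (Nat.succ_le_of_lt hpq).eq_or_lt with hadj | hlt
  · exact ⟨⟨p, by omega⟩, hp.trans (congrArg Sum.inl (Fin.ext hadj.symm))⟩
  let r : Fin m := ⟨p + 1, by omega⟩
  have hr := P.pos_mate_mem_Ioo (p := Sum.inl p) (q := Sum.inl r)
    (by rw [hp]; exact ⟨Nat.lt_succ_self _, hlt⟩)
  have hne := P.mate_ne (Sum.inl r)
  rw [hp] at hr
  rcases hs : P.mate (Sum.inl r) with s | j <;> rw [hs] at hr hne <;>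
    simp only [pos, Set.mem_Ioo] at hr
  · have hrs : r < s := lt_of_le_of_ne hr.1 fun h => hne (congrArg Sum.inl h.symm)
    exact ih (s - r) (by simp only [r]; omega) hrs hs rfl
  · have := j.isLt
    omega

theorem Diagram.reflect_e (i : Fin (n - 1)) : (Diagram.e i).reflect = Diagram.e i := by
  refine Diagram.eq_e_iff.2 ⟨congrArg Sum.swap (Diagram.e_mate_inr_lo i),
    congrArg Sum.swap (Diagram.e_mate_inl_lo i), fun j hlo hhi => ?_⟩
  have hj : (Diagram.e i).mate (Sum.inl j) = Sum.inr j :=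
    Diagram.e_mate_inl_of_ne (Fin.ext_iff.not.2 hlo) (Fin.ext_iff.not.2 hhi)
  exact congrArg Sum.swap ((congrArg _ hj).symm.trans (Diagram.mate_mate _ _))

theorem reflect_e (i : Fin (n - 1)) : reflect (e i) = e i := by
  rw [e_eq, reflect_single, Diagram.reflect_e]

theorem reflect_jonesWenzl_comp_e (i : Fin (n - 1)) :
    comp (reflect (jonesWenzl n)) (e i) = 0 := by
  rw [← reflect_e, ← reflect_comp, e_comp_jonesWenzl, reflect_zero]

theorem reflect_jonesWenzl_comp_single (P : Diagram m n) (h : n < m) :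
    comp (reflect (jonesWenzl m)) (single P) = 0 := by
  obtain ⟨p, q, hpq, hp⟩ := P.exists_cup_of_lt h
  obtain ⟨i, hi⟩ := P.exists_adjacent_cup hpq hp
  have hd : d • comp (reflect (jonesWenzl m)) (single P) = 0 := by
    rw [← comp_smul, ← e_comp_single hi, ← comp_assoc, reflect_jonesWenzl_comp_e, zero_comp]
  exact (smul_eq_zero.1 hd).resolve_left d_ne_zero

theorem jonesWenzl_comp_comp_jonesWenzl (h : m ≠ n) (x : TL m n) :
    comp (reflect (jonesWenzl m)) (comp x (jonesWenzl n)) = 0 := by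
  refine LinearMap.congr_fun (f := compₗ (reflect (jonesWenzl m)) ∘ₗ compₗ.flip (jonesWenzl n))
    (g := 0) (ext_single fun P => ?_) x
  change comp (reflect (jonesWenzl m)) (comp (single P) (jonesWenzl n)) = 0
  rcases lt_or_gt_of_ne h with hlt | hlt
  · rw [← reflect_reflect (comp (single P) _), reflect_comp, reflect_single,
      reflect_jonesWenzl_comp_single _ hlt, reflect_zero, comp_zero]
  · rw [← comp_assoc, reflect_jonesWenzl_comp_single P hlt, zero_comp]

theorem exists_halfTree_eq_comp_jonesWenzl (s : ℕ → ℕ) (k c : ℕ) :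
    ∃ x, halfTree s (k + 2) c = comp x (jonesWenzl c) := by
  rw [halfTree, triplePoint, ← comp_assoc (addLeft (jonesWenzl _)), ← comp_assoc]
  exact ⟨_, rfl⟩

theorem halfTree_orthogonal {s t : ℕ → ℕ} (hfirst : s 1 = t 1) {k : ℕ}
    (hst : ∃ i, 1 ≤ i ∧ i ≤ k ∧ s i ≠ t i) :
    comp (reflect (halfTree s k (s k))) (halfTree t k (t k)) = 0 := by
  obtain ⟨i, hi, hik, hne⟩ := hst
  induction k with
  | zero => omega
  | succ k ih =>
    rcases k with _ | k
    · exact absurd hfirst (by rwa [le_antisymm hik hi] at hne)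
    by_cases hlast : s (k + 2) = t (k + 2)
    · have hik' : i ≤ k + 1 := Nat.le_of_lt_succ (hik.lt_of_ne fun h => hne (h ▸ hlast))
      rw [halfTree, halfTree, reflect_comp, reflect_addLeft, comp_assoc,
        ← comp_assoc (addLeft (reflect _)), ← addLeft_comp, ih hik', addLeft_zero, zero_comp,
        comp_zero]
    · obtain ⟨x, hx⟩ := exists_halfTree_eq_comp_jonesWenzl s k (s (k + 2))
      obtain ⟨y, hy⟩ := exists_halfTree_eq_comp_jonesWenzl t k (t (k + 2))
      rw [hx, hy, reflect_comp, comp_assoc, ← comp_assoc (reflect x),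
        jonesWenzl_comp_comp_jonesWenzl hlast]

theorem D_comp_reflect_D (n : ℕ) (a b : ℕ → ℕ) : comp (D n a) (reflect (D n b)) =
    comp (halfTree a n (a n)) (comp
      (comp (reflect (halfTree (fun i => a (2 * n - i)) n (a n)))
        (halfTree (fun i => b (2 * n - i)) n (b n)))
      (reflect (halfTree b n (b n)))) := by
  rw [D, D, reflect_comp, reflect_reflect, comp_assoc, comp_assoc]

end TemperleyLieb

end

open TemperleyLieb in
theorem mainTheorem2_general (n : ℕ) (a b : ℕ → ℕ) (hfirst : a 1 = b 1)
    (hlast : a (2 * n - 1) = b (2 * n - 1)) (hab : ∃ i, 1 ≤ i ∧ i ≤ 2 * n - 1 ∧ a i ≠ b i) :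
    form (D n a) (D n b) = 0 := by
  rw [form_eq_form_comp_reflect, D_comp_reflect_D]
  obtain ⟨i, hi, hin, hne⟩ := hab
  rcases le_or_gt i n with hle | hgt
  · rw [form_comp_comm, comp_assoc, comp_assoc,
      halfTree_orthogonal hfirst.symm ⟨i, hi, hle, hne.symm⟩, comp_zero, comp_zero, form_zero]
  · have hn : 2 * n - n = n := by omega
    have hlower := halfTree_orthogonal (s := fun i => a (2 * n - i)) (t := fun i => b (2 * n - i))
      hlast (k := n) ⟨2 * n - i, by omega, by omega, by rwa [Nat.sub_sub_self (by omega)]⟩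
    rw [hn] at hlower
    rw [hlower, zero_comp, comp_zero, form_zero]

theorem mainTheorem2 (n : ℕ) (hn : 1 ≤ n) (a b : ℕ → ℕ)
    (ha : TemperleyLieb.Admissible n a) (hb : TemperleyLieb.Admissible n b)
    (hab : ∃ i, 1 ≤ i ∧ i ≤ 2 * n - 1 ∧ a i ≠ b i) :
    TemperleyLieb.form (TemperleyLieb.D n a) (TemperleyLieb.D n b) = 0 :=
  mainTheorem2_general n a b (ha.first.trans hb.first.symm) (ha.last.trans hb.last.symm) hab
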